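/- Let $m,d\ge 1$ be integers, let $1<p<\infty$, and let $\Omega\subset\mathbb{R}^d$ be an open set (in particular, any bounded open set with Lipschitz boundary). Let $L:\Omega\times\mathbb{R}^m\times\mathbb{M}^{m\times d}\to[0,\infty[$ be a Carathéodory function, i.e. $x\mapsto L(x,v,\xi)$ is Lebesgue measurable on $\Omega$ for every $(v,\xi)\in\mathbb{R}^m\times\mathbb{M}^{m\times d}$, and $(v,\xi)\mapsto L(x,v,\xi)$ is continuous for almost every $x\in\Omega$. Assume that $L$ has $p$-growth and is $p$-coercive: there exist $\alpha,\beta>0$ and $a\in L^1(\Omega)$ such that for almost every $x\in\Omega$ and all $(v,\xi)\in\mathbb{R}^m\times\mathbb{M}^{m\times d}$ $$\alpha|\xi|^p\le L(x,v,\xi)\le\beta\bigl(a(x)+|v|^p+|\xi|^p\bigr).$$ Let $Y=\left]-\tfrac12,\tfrac12\right[^d$ and $Q_\rho(x)=x+\rho Y$ for $x\in\mathbb{R}^d$, $\rho>0$. For an open set $U$ and $1\le q<\infty$ let $W^{1,q}_0(U;\mathbb{R}^m)$ be the closure of $C_c^\infty(U;\mathbb{R}^m)$ in $W^{1,q}(U;\mathbb{R}^m)$,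 and let $W^{1,\infty}_0(U;\mathbb{R}^m)=W^{1,\infty}(U;\mathbb{R}^m)\cap W^{1,1}_0(U;\mathbb{R}^m)$. For $(x,v,\xi)\in\Omega\times\mathbb{R}^m\times\mathbb{M}^{m\times d}$ put $$\widetilde L_0(x,v,\xi)=\limsup_{\rho\to0^+}\ \inf\left\{\frac1{\rho^d}\int_{Q_\rho(x)}L\bigl(y,\,v+\xi(y-x)+\varphi(y),\,\xi+\nabla\varphi(y)\bigr)\,dy:\ \varphi\in W^{1,p}_0(Q_\rho(x);\mathbb{R}^m)\right\}$$ (only those $\rho$ with $Q_\rho(x)\subset\Omega$ matter). Then for almost every $x\in\Omega$ and for every $(v,\xi)\in\mathbb{R}^m\times\mathbb{M}^{m\times d}$ $$\widetilde L_0(x,v,\xi)=\inf\left\{\int_Y L\bigl(x,v,\xi+\nabla\varphi(y)\bigr)\,dy:\ \varphi\in W^{1,\infty}_0(Y;\mathbb{R}^m)\right\}.$$ -/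

import Mathlib

open MeasureTheory Filter Topology
open scoped NNReal ENNReal ContDiff

noncomputable section

namespace CalcVar

/-- The Euclidean (Frobenius) norm of a matrix. -/
def matNorm {m d : ℕ} (ξ : Matrix (Fin m) (Fin d) ℝ) : ℝ :=
  Real.sqrt (∑ i, ∑ j, ξ i j ^ 2)

/-- The product of the matrix `ξ` and the Euclidean vector `z`, as a Euclidean vector. -/
def matApply {m d : ℕ} (ξ : Matrix (Fin m) (Fin d) ℝ) (z : EuclideanSpace ℝ (Fin d)) :
    EuclideanSpace ℝ (Fin m) :=
  WithLp.toLp 2 (ξ.mulVec (fun j => z j))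

/-- The open cube with centre `x`, side length `ρ` and faces parallel to the coordinate
hyperplanes. -/
def cube {d : ℕ} (x : EuclideanSpace ℝ (Fin d)) (ρ : ℝ) : Set (EuclideanSpace ℝ (Fin d)) :=
  {y | ∀ i, |y i - x i| < ρ / 2}

/-- The open unit cube. -/
def unitCube (d : ℕ) : Set (EuclideanSpace ℝ (Fin d)) := cube 0 1

/-- The `j`-th classical partial derivative of a real-valued function. -/
def partialDeriv {d : ℕ} (j : Fin d) (f : EuclideanSpace ℝ (Fin d) → ℝ)
    (x : EuclideanSpace ℝ (Fin d)) : ℝ :=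
  fderiv ℝ f x (EuclideanSpace.single j 1)

/-- Smooth maps with compact support contained in the set `U`. -/
structure IsTestFunction {d : ℕ} {F : Type*} [NormedAddCommGroup F] [NormedSpace ℝ F]
    (U : Set (EuclideanSpace ℝ (Fin d))) (η : EuclideanSpace ℝ (Fin d) → F) : Prop where
  smooth : ContDiff ℝ ∞ η
  compact : HasCompactSupport η
  support : tsupport η ⊆ U

/-- `G` is a weak (distributional) gradient of `φ` on the open set `U`. -/
structure IsWeakGradient {m d : ℕ} (U : Set (EuclideanSpace ℝ (Fin d)))
    (φ : EuclideanSpace ℝ (Fin d) → EuclideanSpace ℝ (Fin m))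
    (G : EuclideanSpace ℝ (Fin d) → Matrix (Fin m) (Fin d) ℝ) : Prop where
  locallyIntegrable : ∀ i, LocallyIntegrableOn (fun y => φ y i) U
  locallyIntegrable_grad : ∀ i j, LocallyIntegrableOn (fun y => G y i j) U
  integral_eq : ∀ i j, ∀ η : EuclideanSpace ℝ (Fin d) → ℝ, IsTestFunction U η →
    ∫ y in U, φ y i * partialDeriv j η y = - ∫ y in U, G y i j * η y

/-- `φ` belongs to the Sobolev space `W^{1,q}(U; ℝ^m)`, with weak gradient `G`
(which `φ` determines almost everywhere in `U`). -/
structure MemW1 {m d : ℕ} (q : ℝ≥0∞) (U : Set (EuclideanSpace ℝ (Fin d)))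
    (φ : EuclideanSpace ℝ (Fin d) → EuclideanSpace ℝ (Fin m))
    (G : EuclideanSpace ℝ (Fin d) → Matrix (Fin m) (Fin d) ℝ) : Prop where
  memLp : ∀ i, MemLp (fun y => φ y i) q (volume.restrict U)
  memLp_grad : ∀ i j, MemLp (fun y => G y i j) q (volume.restrict U)
  weakGradient : IsWeakGradient U φ G

/-- For `q < ∞`: `φ` belongs to `W^{1,q}_0(U; ℝ^m)`, the closure of the test maps in
`W^{1,q}(U; ℝ^m)`, with weak gradient `G`. -/
structure MemW10 {m d : ℕ} (q : ℝ≥0∞) (U : Set (EuclideanSpace ℝ (Fin d)))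
    (φ : EuclideanSpace ℝ (Fin d) → EuclideanSpace ℝ (Fin m))
    (G : EuclideanSpace ℝ (Fin d) → Matrix (Fin m) (Fin d) ℝ) : Prop where
  memW1 : MemW1 q U φ G
  approx : ∃ ψ : ℕ → EuclideanSpace ℝ (Fin d) → EuclideanSpace ℝ (Fin m),
    (∀ n, IsTestFunction U (ψ n)) ∧
    (∀ i, Tendsto (fun n => eLpNorm (fun y => ψ n y i - φ y i) q (volume.restrict U))
      atTop (𝓝 0)) ∧
    (∀ i j, Tendsto (fun n => eLpNorm
      (fun y => partialDeriv j (fun z => ψ n z i) y - G y i j) q (volume.restrict U))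
      atTop (𝓝 0))

/-- `φ` belongs to `W^{1,∞}_0(U; ℝ^m) = W^{1,∞}(U; ℝ^m) ∩ W^{1,1}_0(U; ℝ^m)`, with weak
gradient `G`. -/
structure MemW10Infty {m d : ℕ} (U : Set (EuclideanSpace ℝ (Fin d)))
    (φ : EuclideanSpace ℝ (Fin d) → EuclideanSpace ℝ (Fin m))
    (G : EuclideanSpace ℝ (Fin d) → Matrix (Fin m) (Fin d) ℝ) : Prop where
  memW1 : MemW1 ∞ U φ G
  memW10 : MemW10 1 U φ G

/-- `L` is a Carathéodory integrand on `Ω`: Lebesgue measurable in `x`, and continuous in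
`(v, ξ)` for almost every `x`. -/
structure IsCaratheodory {m d : ℕ} (Ω : Set (EuclideanSpace ℝ (Fin d)))
    (L : EuclideanSpace ℝ (Fin d) → EuclideanSpace ℝ (Fin m) →
      Matrix (Fin m) (Fin d) ℝ → ℝ≥0) : Prop where
  measurable : ∀ v ξ, AEMeasurable (fun x => L x v ξ) (volume.restrict Ω)
  continuous : ∀ᵐ x ∂(volume.restrict Ω),
    Continuous (fun w : EuclideanSpace ℝ (Fin m) × Matrix (Fin m) (Fin d) ℝ => L x w.1 w.2)

/-- `p`-growth and `p`-coercivity of `L` on `Ω`. -/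
def HasPGrowth {m d : ℕ} (p : ℝ) (Ω : Set (EuclideanSpace ℝ (Fin d)))
    (L : EuclideanSpace ℝ (Fin d) → EuclideanSpace ℝ (Fin m) →
      Matrix (Fin m) (Fin d) ℝ → ℝ≥0) : Prop :=
  ∃ α : ℝ, 0 < α ∧ ∃ β : ℝ, 0 < β ∧ ∃ a : EuclideanSpace ℝ (Fin d) → ℝ,
    IntegrableOn a Ω ∧ ∀ᵐ x ∂(volume.restrict Ω), ∀ v ξ,
      α * matNorm ξ ^ p ≤ (L x v ξ : ℝ) ∧
      (L x v ξ : ℝ) ≤ β * (a x + ‖v‖ ^ p + matNorm ξ ^ p)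

/-- The cell-formula integrand
`limsup_{ρ → 0} inf { ⨍_{Q_ρ(x)} L(y, v + ξ(y - x) + φ(y), ξ + ∇φ(y)) dy :
φ ∈ W^{1,p}_0(Q_ρ(x); ℝ^m) }`. -/
def cellIntegrand {m d : ℕ} (p : ℝ)
    (L : EuclideanSpace ℝ (Fin d) → EuclideanSpace ℝ (Fin m) →
      Matrix (Fin m) (Fin d) ℝ → ℝ≥0)
    (x : EuclideanSpace ℝ (Fin d)) (v : EuclideanSpace ℝ (Fin m))
    (ξ : Matrix (Fin m) (Fin d) ℝ) : ℝ≥0∞ :=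
  limsup (fun ρ : ℝ =>
    ⨅ (φ : EuclideanSpace ℝ (Fin d) → EuclideanSpace ℝ (Fin m))
      (G : EuclideanSpace ℝ (Fin d) → Matrix (Fin m) (Fin d) ℝ)
      (_ : MemW10 (ENNReal.ofReal p) (cube x ρ) φ G),
      ⨍⁻ y in cube x ρ, (L y (v + matApply ξ (y - x) + φ y) (ξ + G y) : ℝ≥0∞) ∂volume)
    (𝓝[>] 0)

/-- The Dacorogna formula `inf { ∫_Y L(x, v, ξ + ∇φ(y)) dy : φ ∈ W^{1,∞}_0(Y; ℝ^m) }`. -/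
def dacorognaFormula {m d : ℕ}
    (L : EuclideanSpace ℝ (Fin d) → EuclideanSpace ℝ (Fin m) →
      Matrix (Fin m) (Fin d) ℝ → ℝ≥0)
    (x : EuclideanSpace ℝ (Fin d)) (v : EuclideanSpace ℝ (Fin m))
    (ξ : Matrix (Fin m) (Fin d) ℝ) : ℝ≥0∞ :=
  ⨅ (φ : EuclideanSpace ℝ (Fin d) → EuclideanSpace ℝ (Fin m))
    (G : EuclideanSpace ℝ (Fin d) → Matrix (Fin m) (Fin d) ℝ)
    (_ : MemW10Infty (unitCube d) φ G),
    ∫⁻ y in unitCube d, (L x v (ξ + G y) : ℝ≥0∞)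

end CalcVar

end

/-! Rescaling the cube of side `ρ` at `x` to the unit cube turns the cell problem into minimising
the integral of `f (x + ρ • z) (v + ρ • (ξ z + ψ z), ξ + ∇ψ z)` over maps `ψ` vanishing on the
boundary. As `ρ → 0` the base point tends to `x` and the second argument to `v`, so the frozen
energy `f x (v, ξ + ∇ψ)` should remain. Three ingredients make this rigorous.

Freezing the base point: for almost every `x`, the function `y ↦ f y`, seen as a map into continuous
functions on a ball, has `x` as a Lebesgue point in the sup norm
(`IsRegularIntegrand.exists_modulus`). Replacing `f (x + ρ • z)` by `f x` therefore costs a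
vanishing integral, as long as the arguments stay bounded.

Upper bound: a fixed test map has bounded arguments, so dominated convergence suffices
(`limsup_lintegral_blowUp_le`).

Lower bound: near-minimisers depend on `ρ`, and coercivity bounds their gradients only in `L^p`. A
Lipschitz truncation makes them bounded: where the maximal function of the gradient is at most `2 ^
k`, the map is Lipschitz with constant of order `2 ^ k`, and it is extended from there. The growth
condition allows the new energy on the modified set to be of order `2 ^ (k * p)` times its volume,
which the weak-type inequality at a single level merely bounds. For `p > 1` the sum of these
quantities over `N` dyadic levels is still bounded by the `L^p` energy, so some level `k < N` has a
cost of order `1 / N` (`exists_level_maximalSet`). All Lipschitz constants are bounded in terms of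
`N` alone, so `N` is fixed first and `ρ` afterwards (`iInf_testFunction_le_of_eventually`).

Finally, smooth compactly supported maps give the same infimum as `W^{1,p}_0` in the cell problem,
by `p`-growth, and the same infimum as `W^{1,∞}_0` in the frozen one, by mollification and a slight
dilation. -/

namespace CalcVar

/-! ### Cubes, affine changes of variables, comparison with balls. -/

section Cubes

variable {d : ℕ}

theorem isOpen_cube (x : EuclideanSpace ℝ (Fin d)) (ρ : ℝ) : IsOpen (cube x ρ) := by
  have : cube x ρ = ⋂ i, {y : EuclideanSpace ℝ (Fin d) | |y i - x i| < ρ / 2} := by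
    ext y; simp [cube]
  rw [this]
  refine isOpen_iInter_of_finite fun i => isOpen_lt ?_ continuous_const
  fun_prop

theorem measurableSet_cube (x : EuclideanSpace ℝ (Fin d)) (ρ : ℝ) : MeasurableSet (cube x ρ) :=
  (isOpen_cube x ρ).measurableSet

theorem mem_cube_iff_mem_unitCube (x z : EuclideanSpace ℝ (Fin d)) {ρ : ℝ} (hρ : 0 < ρ) :
    x + ρ • z ∈ cube x ρ ↔ z ∈ unitCube d := by
  simp only [cube, unitCube, Set.mem_ofPred_eq, PiLp.add_apply, PiLp.smul_apply, smul_eq_mul,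
    PiLp.zero_apply, add_sub_cancel_left, sub_zero, abs_mul, abs_of_pos hρ]
  refine forall_congr' fun i => ?_
  rw [show ρ / 2 = ρ * (1 / 2) by ring, mul_lt_mul_iff_right₀ hρ]

theorem volume_unitCube : volume (unitCube d) = 1 := by
  have h : unitCube d = (WithLp.ofLp : EuclideanSpace ℝ (Fin d) → Fin d → ℝ) ⁻¹'
      (Set.univ.pi fun _ => Set.Ioo (-(1 / 2)) (1 / 2)) := by
    ext y
    simp [unitCube, cube, abs_lt]
  rw [h, (PiLp.volume_preserving_ofLp (Fin d)).measure_preimage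
    (MeasurableSet.univ_pi fun _ => measurableSet_Ioo).nullMeasurableSet, Real.volume_pi_Ioo]
  norm_num

/-- The affine map is a measurable equivalence, so `f` may be arbitrary. This matters because the
cell formula integrates `L` along competitors before any measurability of the composition is known.
-/
theorem lintegral_comp_affine (b : EuclideanSpace ℝ (Fin d)) {s : ℝ} (hs : 0 < s)
    (f : EuclideanSpace ℝ (Fin d) → ℝ≥0∞) :
    ENNReal.ofReal (s ^ d) * ∫⁻ z, f (b + s • z) = ∫⁻ y, f y := by
  let e : EuclideanSpace ℝ (Fin d) ≃ᵐ EuclideanSpace ℝ (Fin d) :=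
    ((Homeomorph.smulOfNeZero s hs.ne').trans (Homeomorph.addLeft b)).toMeasurableEquiv
  have he : ∀ z, e z = b + s • z := fun z => rfl
  have hmap : Measure.map e volume = ENNReal.ofReal (s ^ d)⁻¹ • volume := by
    have h1 : (e : EuclideanSpace ℝ (Fin d) → EuclideanSpace ℝ (Fin d)) =
      (fun y => b + y) ∘ (fun z => s • z) := rfl
    rw [h1, ← Measure.map_map (by fun_prop) (by fun_prop), Measure.map_addHaar_smul _ hs.ne',
      Measure.map_smul, map_add_left_eq_self]
    simp [abs_of_pos hs]
  have h2 := lintegral_map_equiv (μ := volume) f e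
  rw [hmap, lintegral_smul_measure] at h2
  simp only [he] at h2
  rw [← h2, smul_eq_mul, ← mul_assoc, ← ENNReal.ofReal_mul (by positivity),
    mul_inv_cancel₀ (by positivity)]
  simp

/-- Affine change of variables from a cube to the unit cube. -/
theorem lintegral_cube_eq (x : EuclideanSpace ℝ (Fin d)) {ρ : ℝ} (hρ : 0 < ρ)
    (f : EuclideanSpace ℝ (Fin d) → ℝ≥0∞) :
    ∫⁻ y in cube x ρ, f y =
      ENNReal.ofReal (ρ ^ d) * ∫⁻ z in unitCube d, f (x + ρ • z) := by
  rw [← lintegral_indicator (measurableSet_cube x ρ),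
    ← lintegral_indicator (show MeasurableSet (unitCube d) from measurableSet_cube 0 1),
    ← lintegral_comp_affine x hρ]
  congr 2
  ext z
  by_cases hz : z ∈ unitCube d
  · rw [Set.indicator_of_mem hz, Set.indicator_of_mem ((mem_cube_iff_mem_unitCube x z hρ).2 hz)]
  · rw [Set.indicator_of_notMem hz,
      Set.indicator_of_notMem (mt (mem_cube_iff_mem_unitCube x z hρ).1 hz)]

theorem volume_cube (x : EuclideanSpace ℝ (Fin d)) {ρ : ℝ} (hρ : 0 < ρ) :
    volume (cube x ρ) = ENNReal.ofReal (ρ ^ d) := by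
  have := lintegral_cube_eq x hρ 1
  simpa [volume_unitCube] using this

theorem setLAverage_cube_eq (x : EuclideanSpace ℝ (Fin d)) {ρ : ℝ} (hρ : 0 < ρ)
    (f : EuclideanSpace ℝ (Fin d) → ℝ≥0∞) :
    ⨍⁻ y in cube x ρ, f y ∂volume = ∫⁻ z in unitCube d, f (x + ρ • z) := by
  rw [setLAverage_eq, lintegral_cube_eq x hρ, volume_cube x hρ, mul_comm,
    ENNReal.mul_div_cancel_right]
  · simp [hρ]
  · simp

theorem norm_le_sum_abs (z : EuclideanSpace ℝ (Fin d)) : ‖z‖ ≤ ∑ i, |z i| := by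
  rw [EuclideanSpace.norm_eq]
  refine Real.sqrt_le_iff.2 ⟨Finset.sum_nonneg fun _ _ => abs_nonneg _, ?_⟩
  exact Finset.sum_sq_le_sq_sum_of_nonneg fun _ _ => abs_nonneg _

theorem norm_le_of_mem_cube {x y : EuclideanSpace ℝ (Fin d)} {ρ : ℝ} (hy : y ∈ cube x ρ) :
    ‖y - x‖ ≤ d * (ρ / 2) := by
  refine (norm_le_sum_abs _).trans ?_
  refine (Finset.sum_le_card_nsmul _ _ (ρ / 2) fun i _ => ?_).trans (by simp)
  simpa using (hy i).le

theorem cube_subset_closedBall (x : EuclideanSpace ℝ (Fin d)) {ρ : ℝ} (hρ : 0 < ρ) :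
    cube x ρ ⊆ Metric.closedBall x ((d + 1) * ρ) := by
  intro y hy
  rw [Metric.mem_closedBall, dist_eq_norm]
  refine (norm_le_of_mem_cube hy).trans ?_
  have : (0 : ℝ) ≤ d := d.cast_nonneg
  nlinarith

/-- The differentiation theorem used below is for balls. A cube fills a fixed fraction of a
concentric ball, so averages that vanish on balls vanish on cubes. -/
theorem setLAverage_cube_le (x : EuclideanSpace ℝ (Fin d)) {ρ : ℝ} (hρ : 0 < ρ)
    (f : EuclideanSpace ℝ (Fin d) → ℝ≥0∞) :
    ⨍⁻ y in cube x ρ, f y ∂volume ≤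
      (ENNReal.ofReal ((d + 1) ^ d) * volume (Metric.ball (0 : EuclideanSpace ℝ (Fin d)) 1)) *
      ((∫⁻ y in Metric.closedBall x ((d + 1) * ρ), f y) /
        volume (Metric.closedBall x ((d + 1) * ρ))) := by
  have hd : (0 : ℝ) ≤ d := d.cast_nonneg
  have hpos : 0 < (d + 1) * ρ := by positivity
  rw [setLAverage_eq, volume_cube x hρ, Measure.addHaar_closedBall _ _ hpos.le]
  set B := volume (Metric.ball (0 : EuclideanSpace ℝ (Fin d)) 1)
  have hB0 : B ≠ 0 := (Metric.measure_ball_pos _ _ one_pos).ne'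
  have hB1 : B ≠ ⊤ := measure_ball_lt_top.ne
  have hfin : Module.finrank ℝ (EuclideanSpace ℝ (Fin d)) = d := by simp
  rw [hfin, mul_pow, ENNReal.ofReal_mul (by positivity)]
  set K := ENNReal.ofReal ((d + 1 : ℝ) ^ d)
  have hK0 : K ≠ 0 := by simp only [K, ne_eq, ENNReal.ofReal_eq_zero, not_le]; positivity
  have hK1 : K ≠ ⊤ := ENNReal.ofReal_ne_top
  set r := ENNReal.ofReal (ρ ^ d)
  have hr0 : r ≠ 0 := by simp [r, hρ]
  have hr1 : r ≠ ⊤ := ENNReal.ofReal_ne_top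
  have hI := lintegral_mono_set (μ := volume) (f := f) (cube_subset_closedBall x hρ)
  refine (ENNReal.div_le_div_right hI _).trans (le_of_eq ?_)
  rw [ENNReal.div_eq_inv_mul, ENNReal.div_eq_inv_mul,
    show K * r * B = (K * B) * r by ring,
    ENNReal.mul_inv (Or.inr hr1) (Or.inr hr0), ← mul_assoc, ← mul_assoc,
    ENNReal.mul_inv_cancel (mul_ne_zero hK0 hB0) (ENNReal.mul_ne_top hK1 hB1), one_mul]

theorem cube_subset_of_mem_nhds {x : EuclideanSpace ℝ (Fin d)} {U : Set (EuclideanSpace ℝ (Fin d))}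
    (hU : U ∈ 𝓝 x) : ∀ᶠ ρ in 𝓝[>] (0 : ℝ), cube x ρ ⊆ U := by
  obtain ⟨ε, hε, hsub⟩ := Metric.mem_nhds_iff.1 hU
  have h : ∀ᶠ ρ in 𝓝[>] (0 : ℝ), (d + 1) * ρ < ε := by
    refine nhdsWithin_le_nhds (ContinuousAt.eventually_lt (by fun_prop) (by fun_prop) ?_)
    simpa using hε
  filter_upwards [h, self_mem_nhdsWithin] with ρ h1 h2
  exact ((cube_subset_closedBall x h2).trans (Metric.closedBall_subset_ball h1)).trans hsub

end Cubes

/-! ### Regular integrands and their uniform Lebesgue points. -/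

section Integrands

variable {E W : Type*} [MeasurableSpace E]
  [NormedAddCommGroup W]

/-- A nonnegative integrand which is everywhere measurable in the first variable, everywhere
continuous in the second, and of `p`-growth. -/
structure IsRegularIntegrand (μ : Measure E) (p : ℝ) (a : E → ℝ) (f : E → W → ℝ≥0) : Prop where
  continuous : ∀ y, Continuous (f y)
  measurable : ∀ w, Measurable fun y => f y w
  nonneg : ∀ y, 0 ≤ a y
  integrable : Integrable a μ
  upper : ∃ c : ℝ, 0 ≤ c ∧ ∀ y w, (f y w : ℝ) ≤ a y + c * ‖w‖ ^ p

/-- The sup distance is a supremum over a dense sequence of `K`, so preimages of closed balls are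
countable intersections of measurable sets. By separability of `C(K, ℝ)`, every open set is a
countable union of closed balls. -/
theorem measurable_of_measurable_eval {α K : Type*} [MeasurableSpace α] [TopologicalSpace K]
    [CompactSpace K] [TopologicalSpace.SeparableSpace K] [SecondCountableTopology C(K, ℝ)]
    [MeasurableSpace C(K, ℝ)] [BorelSpace C(K, ℝ)]
    {F : α → C(K, ℝ)} (hF : ∀ k, Measurable fun y => F y k) : Measurable F := by
  rcases isEmpty_or_nonempty K with hK | hK
  · have : F = fun _ => 0 := by
      ext y k; exact isEmptyElim k
    rw [this]; exact measurable_const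
  have hball : ∀ (g : C(K, ℝ)) (r : ℝ), MeasurableSet (F ⁻¹' Metric.closedBall g r) := by
    intro g r
    by_cases hr : 0 ≤ r
    · have : F ⁻¹' Metric.closedBall g r =
          ⋂ n : ℕ, {y | |F y (TopologicalSpace.denseSeq K n) -
            g (TopologicalSpace.denseSeq K n)| ≤ r} := by
        ext y
        simp only [Set.mem_preimage, Metric.mem_closedBall, Set.mem_iInter, Set.mem_ofPred_eq]
        rw [ContinuousMap.dist_le hr]
        constructor
        · intro h n
          exact h _
        · intro h k
          have hcl : IsClosed {k | dist (F y k) (g k) ≤ r} :=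
            isClosed_le (by fun_prop) continuous_const
          have := (TopologicalSpace.denseRange_denseSeq K).closure_eq ▸
            closure_minimal (Set.range_subset_iff.2 h) hcl
          exact this (Set.mem_univ k)
      rw [this]
      refine MeasurableSet.iInter fun n => measurableSet_le ?_ measurable_const
      exact ((hF _).sub measurable_const).abs
    · rw [Metric.closedBall_eq_empty.2 (not_le.1 hr)]; exact MeasurableSet.empty
  refine measurable_of_isOpen fun U hU => ?_
  have hUe : U = ⋃ n : ℕ, ⋃ q : {q : ℚ //
      Metric.closedBall (TopologicalSpace.denseSeq C(K, ℝ) n) (q : ℝ) ⊆ U},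
      Metric.closedBall (TopologicalSpace.denseSeq C(K, ℝ) n) (q : ℝ) := by
    apply Set.Subset.antisymm
    · intro g hg
      obtain ⟨ε, hε, hsub⟩ := Metric.isOpen_iff.1 hU g hg
      obtain ⟨q, hq0, hq1⟩ := exists_rat_btwn (show (0 : ℝ) < ε / 2 by positivity)
      obtain ⟨n, hn⟩ := (TopologicalSpace.denseRange_denseSeq C(K, ℝ)).exists_dist_lt g hq0
      refine Set.mem_iUnion.2 ⟨n, Set.mem_iUnion.2 ⟨⟨q, fun h hh => hsub ?_⟩, hn.le⟩⟩
      rw [Metric.mem_closedBall] at hh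
      rw [Metric.mem_ball]
      have := dist_triangle h (TopologicalSpace.denseSeq C(K, ℝ) n) g
      rw [dist_comm] at hn
      linarith
    · exact Set.iUnion_subset fun n => Set.iUnion_subset fun q => q.2
  rw [hUe]
  simp only [Set.preimage_iUnion]
  exact MeasurableSet.iUnion fun n => MeasurableSet.iUnion fun q => hball _ _

theorem measurable_comp_integrand [MeasurableSpace W] [BorelSpace W] [SecondCountableTopology W]
    {f : E → W → ℝ≥0} (hc : ∀ y, Continuous (f y)) (hm : ∀ w, Measurable fun y => f y w)
    {u : E → W} (hu : Measurable u) : Measurable fun y => f y (u y) := by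
  have := measurable_uncurry_of_continuous_of_measurable (u := fun w y => f y w) hc hm
  exact this.comp (hu.prodMk measurable_id)

end Integrands

/-- Almost every point is a Lebesgue point of `y ↦ f y`, uniformly on bounded sets. -/
theorem IsRegularIntegrand.exists_modulus {d : ℕ} {W : Type*} [NormedAddCommGroup W]
    [ProperSpace W] {p : ℝ} (hp : 0 ≤ p) {a : EuclideanSpace ℝ (Fin d) → ℝ}
    {f : EuclideanSpace ℝ (Fin d) → W → ℝ≥0} (hf : IsRegularIntegrand volume p a f) (R : ℝ) :
    ∀ᵐ x, ∃ h : EuclideanSpace ℝ (Fin d) → ℝ≥0∞, Measurable h ∧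
      (∀ y w, ‖w‖ ≤ R → (f y w : ℝ≥0∞) ≤ f x w + h y ∧ (f x w : ℝ≥0∞) ≤ f y w + h y) ∧
      Tendsto (fun ρ : ℝ => ∫⁻ z in unitCube d, h (x + ρ • z)) (𝓝[>] 0) (𝓝 0) := by
  let K := Metric.closedBall (0 : W) R
  have : CompactSpace K := isCompact_iff_compactSpace.1 (isCompact_closedBall _ _)
  borelize C(K, ℝ)
  -- Currying into `C(K, ℝ)` makes the Lebesgue differentiation theorem uniform over the ball: the
  -- modulus is `h y = ‖F y - F x‖`.
  let F : EuclideanSpace ℝ (Fin d) → C(K, ℝ) := fun y =>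
    ⟨fun w => (f y w : ℝ), by have := hf.continuous y; fun_prop⟩
  have hFm : Measurable F := measurable_of_measurable_eval fun k =>
    (hf.measurable k).coe_nnreal_real
  have hFi : LocallyIntegrable F := by
    obtain ⟨c, hc, hup⟩ := hf.upper
    have hg : LocallyIntegrable (fun y => a y + c * |R| ^ p)
        (volume : Measure (EuclideanSpace ℝ (Fin d))) :=
      hf.integrable.locallyIntegrable.add (locallyIntegrable_const _)
    refine hg.mono hFm.aestronglyMeasurable (Eventually.of_forall fun y => ?_)
    have h0 := hf.nonneg y
    rw [Real.norm_of_nonneg (by positivity)]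
    rw [ContinuousMap.norm_le _ (by positivity)]
    intro w
    have hw : ‖(w : W)‖ ≤ |R| := by
      have := w.2
      rw [mem_closedBall_zero_iff] at this
      exact this.trans (le_abs_self R)
    change ‖((f y w : ℝ≥0) : ℝ)‖ ≤ _
    rw [Real.norm_of_nonneg (NNReal.coe_nonneg _)]
    refine (hup y w).trans ?_
    gcongr
  filter_upwards [(Besicovitch.vitaliFamily volume).ae_tendsto_lintegral_enorm_sub_div hFi]
    with x hx
  refine ⟨fun y => ‖F y - F x‖ₑ, (hFm.sub measurable_const).enorm, fun y w hw => ?_, ?_⟩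
  · have hw' : w ∈ K := by simpa [K] using hw
    have h1 : |(f y w : ℝ) - f x w| ≤ ‖F y - F x‖ := by
      simpa [F] using (F y - F x).norm_coe_le_norm ⟨w, hw'⟩
    have h2 := abs_le.1 h1
    beta_reduce
    rw [← ofReal_norm, ← ENNReal.ofReal_coe_nnreal, ← ENNReal.ofReal_coe_nnreal,
      ← ENNReal.ofReal_add (by positivity) (by positivity),
      ← ENNReal.ofReal_add (by positivity) (by positivity)]
    exact ⟨ENNReal.ofReal_le_ofReal (by linarith), ENNReal.ofReal_le_ofReal (by linarith)⟩
  · have h1 : Tendsto (fun ρ : ℝ => ((d : ℝ) + 1) * ρ) (𝓝[>] 0) (𝓝[>] 0) := by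
      refine tendsto_nhdsWithin_iff.2 ⟨?_, ?_⟩
      · refine tendsto_nhdsWithin_of_tendsto_nhds ?_
        have : ContinuousAt (fun ρ : ℝ => ((d : ℝ) + 1) * ρ) 0 := by fun_prop
        simpa [ContinuousAt] using this
      · filter_upwards [self_mem_nhdsWithin] with ρ hρ
        have : (0 : ℝ) < ρ := hρ
        show (0 : ℝ) < (d + 1) * ρ
        positivity
    have h2 := (hx.comp (Besicovitch.tendsto_filterAt volume x)).comp h1
    have h3 := ENNReal.Tendsto.const_mul
      (a := ENNReal.ofReal ((d + 1) ^ d) * volume (Metric.ball (0 : EuclideanSpace ℝ (Fin d)) 1))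
      h2 (Or.inr (ENNReal.mul_ne_top ENNReal.ofReal_ne_top measure_ball_lt_top.ne))
    rw [mul_zero] at h3
    refine tendsto_of_tendsto_of_tendsto_of_le_of_le' tendsto_const_nhds h3
      (Eventually.of_forall fun _ => zero_le) ?_
    filter_upwards [self_mem_nhdsWithin] with ρ hρ
    rw [← setLAverage_cube_eq x hρ (fun y => ‖F y - F x‖ₑ)]
    exact setLAverage_cube_le x hρ _

/-! ### Test maps: gradients, integration by parts, rescaling. -/

section TestFunctions

variable {m d : ℕ}

/-- The Jacobian matrix of a map, as a function of two indices. -/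
noncomputable def gradMat (ψ : EuclideanSpace ℝ (Fin d) → EuclideanSpace ℝ (Fin m))
    (y : EuclideanSpace ℝ (Fin d)) : Fin m → Fin d → ℝ :=
  fun i j => partialDeriv j (fun z => ψ z i) y

theorem IsTestFunction.component {U : Set (EuclideanSpace ℝ (Fin d))}
    {ψ : EuclideanSpace ℝ (Fin d) → EuclideanSpace ℝ (Fin m)} (hψ : IsTestFunction U ψ)
    (i : Fin m) : IsTestFunction U (fun z => ψ z i) := by
  have hsub : tsupport (fun z => ψ z i) ⊆ tsupport ψ := by
    refine closure_mono fun z hz => ?_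
    contrapose! hz
    have : ψ z = 0 := by simpa using hz
    simp [this]
  refine ⟨?_, ?_, hsub.trans hψ.support⟩
  · exact (EuclideanSpace.proj (𝕜 := ℝ) i : EuclideanSpace ℝ (Fin m) →L[ℝ] ℝ).contDiff.comp
      hψ.smooth
  · exact hψ.compact.of_isClosed_subset (isClosed_tsupport _) hsub

theorem IsTestFunction.mono {F : Type*} [NormedAddCommGroup F] [NormedSpace ℝ F]
    {U V : Set (EuclideanSpace ℝ (Fin d))} {η : EuclideanSpace ℝ (Fin d) → F}
    (hη : IsTestFunction U η) (hUV : U ⊆ V) : IsTestFunction V η :=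
  ⟨hη.smooth, hη.compact, hη.support.trans hUV⟩

section Scalar

variable {U : Set (EuclideanSpace ℝ (Fin d))} {η : EuclideanSpace ℝ (Fin d) → ℝ}

theorem IsTestFunction.differentiable (hη : IsTestFunction U η) : Differentiable ℝ η :=
  hη.smooth.differentiable (by simp)

theorem IsTestFunction.continuous_partialDeriv (hη : IsTestFunction U η) (j : Fin d) :
    Continuous (partialDeriv j η) := by
  have := hη.smooth.continuous_fderiv (by simp)
  unfold partialDeriv
  fun_prop

theorem IsTestFunction.hasCompactSupport_partialDeriv (hη : IsTestFunction U η) (j : Fin d) :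
    HasCompactSupport (partialDeriv j η) :=
  hη.compact.fderiv_apply ℝ (EuclideanSpace.single j 1)

theorem IsTestFunction.eq_zero (hη : IsTestFunction U η) {y : EuclideanSpace ℝ (Fin d)}
    (hy : y ∉ U) : η y = 0 :=
  image_eq_zero_of_notMem_tsupport fun h => hy (hη.support h)

theorem partialDeriv_eq_zero_of_notMem {y : EuclideanSpace ℝ (Fin d)} (hy : y ∉ tsupport η)
    (j : Fin d) : partialDeriv j η y = 0 := by
  have : fderiv ℝ η y = 0 := by
    by_contra h
    exact hy (support_fderiv_subset ℝ h)
  simp [partialDeriv, this]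

theorem IsTestFunction.partialDeriv_eq_zero (hη : IsTestFunction U η)
    {y : EuclideanSpace ℝ (Fin d)} (hy : y ∉ U) (j : Fin d) : partialDeriv j η y = 0 :=
  partialDeriv_eq_zero_of_notMem (fun h => hy (hη.support h)) j

theorem integral_mul_partialDeriv {f : EuclideanSpace ℝ (Fin d) → ℝ}
    (hf : IsTestFunction U f) {V : Set (EuclideanSpace ℝ (Fin d))} (hη : IsTestFunction V η)
    (j : Fin d) : ∫ y, f y * partialDeriv j η y = - ∫ y, partialDeriv j f y * η y := by
  have h1 := hη.continuous_partialDeriv j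
  have h2 := hf.continuous_partialDeriv j
  have h3 := hη.smooth.continuous
  have h4 := hf.smooth.continuous
  refine integral_mul_fderiv_eq_neg_fderiv_mul_of_integrable (v := EuclideanSpace.single j 1)
    ?_ ?_ ?_ (fun y _ => hf.differentiable y) (fun y _ => hη.differentiable y)
  · exact (h2.mul h3).integrable_of_hasCompactSupport hη.compact.mul_left
  · exact (h4.mul h1).integrable_of_hasCompactSupport hf.compact.mul_right
  · exact (h4.mul h3).integrable_of_hasCompactSupport hη.compact.mul_left

end Scalar

variable {U : Set (EuclideanSpace ℝ (Fin d))}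
  {ψ : EuclideanSpace ℝ (Fin d) → EuclideanSpace ℝ (Fin m)}

theorem IsTestFunction.isWeakGradient (hψ : IsTestFunction U ψ) :
    IsWeakGradient U ψ (gradMat ψ) where
  locallyIntegrable i := (hψ.component i).smooth.continuous.locallyIntegrable.locallyIntegrableOn U
  locallyIntegrable_grad i j :=
    ((hψ.component i).continuous_partialDeriv j).locallyIntegrable.locallyIntegrableOn U
  integral_eq i j η hη := by
    rw [setIntegral_eq_integral_of_forall_compl_eq_zero, integral_mul_partialDeriv
      (hψ.component i) hη j, setIntegral_eq_integral_of_forall_compl_eq_zero]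
    · rfl
    · intro y hy; simp [hη.eq_zero hy]
    · intro y hy; simp [hη.partialDeriv_eq_zero hy]

theorem IsTestFunction.memW1 (hψ : IsTestFunction U ψ) (q : ℝ≥0∞) :
    MemW1 q U ψ (gradMat ψ) where
  memLp i := ((hψ.component i).smooth.continuous.memLp_of_hasCompactSupport
    (hψ.component i).compact).restrict U
  memLp_grad i j := (((hψ.component i).continuous_partialDeriv j).memLp_of_hasCompactSupport
    ((hψ.component i).hasCompactSupport_partialDeriv j)).restrict U
  weakGradient := hψ.isWeakGradient

theorem IsTestFunction.memW10 (hψ : IsTestFunction U ψ) (q : ℝ≥0∞) :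
    MemW10 q U ψ (gradMat ψ) where
  memW1 := hψ.memW1 q
  approx := ⟨fun _ => ψ, fun _ => hψ, fun i => by simp, fun i j => by simp [gradMat]⟩

theorem IsTestFunction.memW10Infty (hψ : IsTestFunction U ψ) :
    MemW10Infty U ψ (gradMat ψ) :=
  ⟨hψ.memW1 ∞, hψ.memW10 1⟩

theorem IsTestFunction.continuous_gradMat (hψ : IsTestFunction U ψ) : Continuous (gradMat ψ) :=
  continuous_pi fun i => continuous_pi fun j => (hψ.component i).continuous_partialDeriv j

theorem IsTestFunction.gradMat_eq_zero (hψ : IsTestFunction U ψ)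
    {y : EuclideanSpace ℝ (Fin d)} (hy : y ∉ U) : gradMat ψ y = 0 := by
  ext i j
  exact (hψ.component i).partialDeriv_eq_zero hy j

theorem IsTestFunction.comp_affine (hψ : IsTestFunction U ψ) (c : ℝ)
    (b : EuclideanSpace ℝ (Fin d)) {s : ℝ} (hs : s ≠ 0) :
    IsTestFunction ((fun z => b + s • z) ⁻¹' U) (fun z => c • ψ (b + s • z)) := by
  let e : EuclideanSpace ℝ (Fin d) ≃ₜ EuclideanSpace ℝ (Fin d) :=
    (Homeomorph.smulOfNeZero s hs).trans (Homeomorph.addLeft b)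
  have hsub : tsupport (fun z => c • ψ (b + s • z)) ⊆ e ⁻¹' tsupport ψ := by
    rw [← tsupport_comp_eq_preimage ψ e]
    refine closure_mono fun z hz => ?_
    contrapose! hz
    have : ψ (b + s • z) = 0 := by simpa [e] using hz
    simp [this]
  refine ⟨?_, ?_, hsub.trans (Set.preimage_mono hψ.support)⟩
  · have := hψ.smooth
    fun_prop
  · have h1 : IsCompact (e ⁻¹' tsupport ψ) := e.isCompact_preimage.2 hψ.compact
    exact h1.of_isClosed_subset (isClosed_tsupport _) hsub

theorem IsTestFunction.gradMat_comp_affine (hψ : IsTestFunction U ψ) (c : ℝ)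
    (b : EuclideanSpace ℝ (Fin d)) (s : ℝ) (z : EuclideanSpace ℝ (Fin d)) :
    gradMat (fun z => c • ψ (b + s • z)) z = (c * s) • gradMat ψ (b + s • z) := by
  ext i j
  have h1 := ((hψ.component i).differentiable (b + s • z)).hasFDerivAt
  have h2 : HasFDerivAt (fun z : EuclideanSpace ℝ (Fin d) => b + s • z)
      (s • ContinuousLinearMap.id ℝ _) z := ((hasFDerivAt_id z).const_smul s).const_add b
  have h3 := (h1.comp z h2).const_smul c
  have h4 : (fun z => (c • ψ (b + s • z)) i) =
      c • ((fun z => ψ z i) ∘ fun z => b + s • z) := by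
    ext z; simp
  simp only [gradMat, partialDeriv, h4, h3.fderiv, Pi.smul_apply, smul_eq_mul]
  simp [mul_assoc]

/-- A test map on the unit cube, transported to a cube of side `ρ`. -/
theorem IsTestFunction.rescale (hψ : IsTestFunction (unitCube d) ψ)
    (x : EuclideanSpace ℝ (Fin d)) {ρ : ℝ} (hρ : 0 < ρ) :
    ∃ φ : EuclideanSpace ℝ (Fin d) → EuclideanSpace ℝ (Fin m), IsTestFunction (cube x ρ) φ ∧
      (∀ z, φ (x + ρ • z) = ρ • ψ z) ∧ ∀ z, gradMat φ (x + ρ • z) = gradMat ψ z := by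
  have key : ∀ z : EuclideanSpace ℝ (Fin d), -(ρ⁻¹ • x) + ρ⁻¹ • (x + ρ • z) = z := by
    intro z
    rw [smul_add, smul_smul, inv_mul_cancel₀ hρ.ne', one_smul, neg_add_cancel_left]
  refine ⟨_, (hψ.comp_affine ρ (-(ρ⁻¹ • x)) (inv_ne_zero hρ.ne')).mono ?_, fun z => ?_,
    fun z => ?_⟩
  · intro y hy
    rw [Set.mem_preimage, ← mem_cube_iff_mem_unitCube x _ hρ] at hy
    have : x + ρ • (-(ρ⁻¹ • x) + ρ⁻¹ • y) = y := by
      rw [smul_add, smul_neg, smul_smul, smul_smul, mul_inv_cancel₀ hρ.ne', one_smul, one_smul,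
        add_neg_cancel_left]
    rwa [this] at hy
  · simp only [key]
  · rw [hψ.gradMat_comp_affine, key, mul_inv_cancel₀ hρ.ne', one_smul]

/-- A test map on a cube of side `ρ`, transported to the unit cube. -/
theorem IsTestFunction.unscale {x : EuclideanSpace ℝ (Fin d)} {ρ : ℝ} (hρ : 0 < ρ)
    (hψ : IsTestFunction (cube x ρ) ψ) :
    ∃ φ : EuclideanSpace ℝ (Fin d) → EuclideanSpace ℝ (Fin m), IsTestFunction (unitCube d) φ ∧
      (∀ z, ψ (x + ρ • z) = ρ • φ z) ∧ ∀ z, gradMat ψ (x + ρ • z) = gradMat φ z := by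
  refine ⟨_, (hψ.comp_affine ρ⁻¹ x hρ.ne').mono ?_, fun z => ?_, fun z => ?_⟩
  · intro z hz
    exact (mem_cube_iff_mem_unitCube x z hρ).1 hz
  · rw [smul_smul, mul_inv_cancel₀ hρ.ne', one_smul]
  · rw [hψ.gradMat_comp_affine, inv_mul_cancel₀ hρ.ne', one_smul]

end TestFunctions

/-! ### From bounded weak gradients to test maps. -/

section Mollification

variable {m d : ℕ}

theorem closure_cube_subset (x : EuclideanSpace ℝ (Fin d)) {s t : ℝ} (hst : s < t) :
    closure (cube x s) ⊆ cube x t := by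
  have hcl : IsClosed {y : EuclideanSpace ℝ (Fin d) | ∀ i, |y i - x i| ≤ s / 2} := by
    have : {y : EuclideanSpace ℝ (Fin d) | ∀ i, |y i - x i| ≤ s / 2} =
        ⋂ i, {y | |y i - x i| ≤ s / 2} := by ext y; simp
    rw [this]
    exact isClosed_iInter fun i => isClosed_le (by fun_prop) continuous_const
  refine (closure_minimal (fun y hy i => (hy i).le) hcl).trans fun y hy i => ?_
  exact (hy i).trans_lt (by linarith)

theorem cube_mono (x : EuclideanSpace ℝ (Fin d)) {s t : ℝ} (hst : s ≤ t) :
    cube x s ⊆ cube x t := fun _ hy i => (hy i).trans_le (by linarith)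

/-- A field vanishing outside of the unit cube and weakly differentiable in the whole space, with
bounded gradient, is mollified to test maps on slightly larger cubes. -/
theorem exists_mollification {φ : EuclideanSpace ℝ (Fin d) → EuclideanSpace ℝ (Fin m)}
    {G : EuclideanSpace ℝ (Fin d) → Fin m → Fin d → ℝ} {Λ : ℝ} (hΛ : 0 ≤ Λ)
    (hφ : ∀ i, LocallyIntegrable fun y => φ y i) (hφ0 : ∀ y ∉ unitCube d, φ y = 0)
    (hG : ∀ i j, LocallyIntegrable fun y => G y i j) (hGb : ∀ᵐ y, ‖G y‖ ≤ Λ)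
    (hw : ∀ i j, ∀ η : EuclideanSpace ℝ (Fin d) → ℝ, IsTestFunction Set.univ η →
      ∫ y, φ y i * partialDeriv j η y = - ∫ y, G y i j * η y) :
    ∃ (ψ : ℕ → EuclideanSpace ℝ (Fin d) → EuclideanSpace ℝ (Fin m)) (s : ℕ → ℝ),
      (∀ n, 1 < s n) ∧ Tendsto s atTop (𝓝 1) ∧ (∀ n, IsTestFunction (cube 0 (s n)) (ψ n)) ∧
      (∀ n y, ‖gradMat (ψ n) y‖ ≤ Λ) ∧
      ∀ᵐ y, Tendsto (fun n => gradMat (ψ n) y) atTop (𝓝 (G y)) := by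
  -- The ratio of outer to inner radius is kept equal to 2, since almost everywhere convergence of
  -- the mollifications needs a bounded ratio.
  let b : ℕ → ContDiffBump (0 : EuclideanSpace ℝ (Fin d)) := fun n =>
    ⟨1 / (n + 1) / 2, 1 / (n + 1), by positivity, half_lt_self (by positivity)⟩
  have hb_out : ∀ n, (b n).rOut = 1 / ((n : ℝ) + 1) := fun n => rfl
  have hb_in : ∀ n, (b n).rIn = 1 / ((n : ℝ) + 1) / 2 := fun n => rfl
  let β : ℕ → EuclideanSpace ℝ (Fin d) → ℝ := fun n => (b n).normed volume
  have hβs : ∀ n, ContDiff ℝ ∞ (β n) := fun n => (b n).contDiff_normed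
  have hβc : ∀ n, HasCompactSupport (β n) := fun n => (b n).hasCompactSupport_normed
  let L := ContinuousLinearMap.lsmul ℝ ℝ (E := ℝ)
  let c : ℕ → Fin m → EuclideanSpace ℝ (Fin d) → ℝ := fun n i =>
    convolution (fun y => φ y i) (β n) L volume
  let ψ : ℕ → EuclideanSpace ℝ (Fin d) → EuclideanSpace ℝ (Fin m) := fun n y =>
    WithLp.toLp 2 fun i => c n i y
  have hψc : ∀ n i, (fun y => ψ n y i) = c n i := fun n i => rfl
  have hc_smooth : ∀ n i, ContDiff ℝ ∞ (c n i) := fun n i =>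
    (hβc n).contDiff_convolution_right L (hφ i) (hβs n)
  -- the gradient of the mollified map
  have hgrad : ∀ n i j y, gradMat (ψ n) y i j = ∫ t, β n (y - t) * G t i j := by
    intro n i j y
    have h1 : HasFDerivAt (c n i) _ y :=
      (hβc n).hasFDerivAt_convolution_right L (hφ i) ((hβs n).of_le (by simp)) y
    have h2 : gradMat (ψ n) y i j = fderiv ℝ (c n i) y (EuclideanSpace.single j 1) := rfl
    rw [h2, h1.fderiv, convolution_precompR_apply L (hφ i) ((hβc n).fderiv ℝ)
      ((hβs n).continuous_fderiv (by simp))]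
    -- Testing the weak gradient against the reflected and translated kernel moves the derivative
    -- from the kernel to `G`.
    let η : EuclideanSpace ℝ (Fin d) → ℝ := fun t => β n (y - t)
    have hη : IsTestFunction Set.univ η := by
      refine ⟨?_, ?_, Set.subset_univ _⟩
      · have := hβs n
        fun_prop
      · exact (hβc n).comp_homeomorph (Homeomorph.subLeft y)
    have hηd : ∀ t, partialDeriv j η t =
        - fderiv ℝ (β n) (y - t) (EuclideanSpace.single j 1) := by
      intro t
      have h3 : HasFDerivAt (fun t => y - t)
        (-ContinuousLinearMap.id ℝ (EuclideanSpace ℝ (Fin d))) t := (hasFDerivAt_id t).const_sub y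
      have h4 := (((hβs n).differentiable (by simp)) (y - t)).hasFDerivAt.comp t h3
      have h5 : η = (β n) ∘ fun t => y - t := rfl
      rw [partialDeriv, h5, h4.fderiv]
      simp
    have h6 := hw i j η hη
    simp only [hηd, mul_neg, integral_neg, neg_inj] at h6
    simp only [convolution_def, L, ContinuousLinearMap.lsmul_apply, smul_eq_mul]
    rw [h6]
    exact integral_congr_ae (Eventually.of_forall fun t => mul_comm _ _)
  -- A kernel of radius `1 / (n + 1)` enlarges the side by `2 / (n + 1)`; the 3 leaves room for
  -- taking the closure.
  have hsupp : ∀ n, tsupport (ψ n) ⊆ cube 0 (1 + 3 / ((n : ℝ) + 1)) := by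
    intro n
    have hn : (0 : ℝ) < (n : ℝ) + 1 := by positivity
    refine (closure_mono ?_).trans (closure_cube_subset 0
      (show 1 + 2 / ((n : ℝ) + 1) < 1 + 3 / ((n : ℝ) + 1) by gcongr; norm_num))
    intro y hy
    by_contra hyc
    apply hy
    ext i
    change ∫ t, L (φ t i) (β n (y - t)) = 0
    refine integral_eq_zero_of_ae (Eventually.of_forall fun t => ?_)
    by_cases ht : t ∈ unitCube d
    · have : β n (y - t) = 0 := by
        by_contra hne
        have hmem : y - t ∈ Function.support (β n) := hne
        rw [(b n).support_normed_eq, mem_ball_zero_iff, hb_out] at hmem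
        apply hyc
        intro k
        have h1 := ht k
        have h2 : |(y - t) k| ≤ ‖y - t‖ := by
          simpa using PiLp.norm_apply_le (y - t) k
        have h3 : y k = (y - t) k + t k := by simp
        simp only [PiLp.zero_apply, sub_zero] at h1 ⊢
        rw [h3]
        have h4 := abs_add_le ((y - t) k) (t k)
        have h5 : 2 / ((n : ℝ) + 1) = 2 * (1 / ((n : ℝ) + 1)) := by ring
        rw [h5]
        linarith
      simp [this]
    · simp [hφ0 t ht]
  refine ⟨ψ, fun n => 1 + 3 / ((n : ℝ) + 1), fun n => ?_, ?_, fun n => ⟨?_, ?_, hsupp n⟩,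
    fun n y => ?_, ?_⟩
  · have : (0 : ℝ) < 3 / ((n : ℝ) + 1) := by positivity
    simpa using this
  · have h := (tendsto_one_div_add_atTop_nhds_zero_nat (𝕜 := ℝ)).const_mul 3
    have h' := h.const_add 1
    simpa [div_eq_mul_inv] using h'
  · exact contDiff_euclidean.2 fun i => hc_smooth n i
  · refine Metric.isCompact_of_isClosed_isBounded (isClosed_tsupport _)
      (Metric.isBounded_closedBall.subset ((hsupp n).trans (cube_subset_closedBall 0 ?_)))
    positivity
  · rw [pi_norm_le_iff_of_nonneg hΛ]
    intro i
    rw [pi_norm_le_iff_of_nonneg hΛ]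
    intro j
    rw [hgrad]
    have h1 : Integrable (fun t => β n (y - t)) := by
      have h0 : Integrable (β n) := (hβs n).continuous.integrable_of_hasCompactSupport (hβc n)
      exact h0.comp_sub_left y
    have h2 : ∫ t, β n (y - t) = 1 := by
      rw [integral_sub_left_eq_self (β n) volume y]
      exact (b n).integral_normed
    calc ‖∫ t, β n (y - t) * G t i j‖ ≤ ∫ t, β n (y - t) * Λ := by
          refine norm_integral_le_of_norm_le (h1.mul_const Λ) ?_
          filter_upwards [hGb] with t ht
          rw [norm_mul, Real.norm_of_nonneg ((b n).nonneg_normed _)]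
          refine mul_le_mul_of_nonneg_left ?_ ((b n).nonneg_normed _)
          exact ((norm_le_pi_norm (G t i) j).trans (norm_le_pi_norm (G t) i)).trans ht
      _ = Λ := by rw [integral_mul_const, h2, one_mul]
  · have h : ∀ i j, ∀ᵐ y, Tendsto (fun n => gradMat (ψ n) y i j) atTop (𝓝 (G y i j)) := by
      intro i j
      have h1 : Tendsto (fun n => (b n).rOut) atTop (𝓝 0) := by
        simp only [hb_out]; exact tendsto_one_div_add_atTop_nhds_zero_nat
      filter_upwards [ContDiffBump.ae_convolution_tendsto_right_of_locallyIntegrable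
        (μ := volume) (K := 2) h1 (Eventually.of_forall fun n => by rw [hb_out, hb_in]; linarith)
        (hG i j)] with y hy
      refine hy.congr fun n => ?_
      rw [convolution_eq_swap, hgrad]
      rfl
    filter_upwards [ae_all_iff.2 fun i => ae_all_iff.2 (h i)] with y hy
    exact tendsto_pi_nhds.2 fun i => tendsto_pi_nhds.2 (hy i)

/-- Infimum over test maps of `∫ g(∇ψ)` is bounded by the value at a bounded gradient field. -/
theorem exists_testFunction_lintegral_lt
    {φ : EuclideanSpace ℝ (Fin d) → EuclideanSpace ℝ (Fin m)}
    {G : EuclideanSpace ℝ (Fin d) → Fin m → Fin d → ℝ} {Λ : ℝ} (hΛ : 0 ≤ Λ)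
    (hφ : ∀ i, LocallyIntegrable fun y => φ y i) (hφ0 : ∀ y ∉ unitCube d, φ y = 0)
    (hG : ∀ i j, LocallyIntegrable fun y => G y i j) (hGb : ∀ᵐ y, ‖G y‖ ≤ Λ)
    (hw : ∀ i j, ∀ η : EuclideanSpace ℝ (Fin d) → ℝ, IsTestFunction Set.univ η →
      ∫ y, φ y i * partialDeriv j η y = - ∫ y, G y i j * η y)
    {g : (Fin m → Fin d → ℝ) → ℝ≥0} (hg : Continuous g) {T : ℝ≥0∞}
    (hT : ∫⁻ y in unitCube d, (g (G y) : ℝ≥0∞) < T) :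
    ∃ ψ : EuclideanSpace ℝ (Fin d) → EuclideanSpace ℝ (Fin m), IsTestFunction (unitCube d) ψ ∧
      ∫⁻ y in unitCube d, (g (gradMat ψ y) : ℝ≥0∞) < T := by
  obtain ⟨ψ, s, hs1, hs, hψ, hψb, hψt⟩ := exists_mollification hΛ hφ hφ0 hG hGb hw
  obtain ⟨C, hC⟩ : ∃ C : ℝ≥0, ∀ ξ : Fin m → Fin d → ℝ, ‖ξ‖ ≤ Λ → g ξ ≤ C := by
    obtain ⟨C, hC⟩ := (isCompact_closedBall (0 : Fin m → Fin d → ℝ) Λ).bddAbove_image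
      hg.continuousOn
    exact ⟨C, fun ξ hξ => hC (Set.mem_image_of_mem g (by simpa using hξ))⟩
  have h1 : Tendsto (fun n => ∫⁻ y in unitCube d, (g (gradMat (ψ n) y) : ℝ≥0∞)) atTop
      (𝓝 (∫⁻ y in unitCube d, (g (G y) : ℝ≥0∞))) := by
    refine tendsto_lintegral_of_dominated_convergence (fun _ => (C : ℝ≥0∞)) (fun n => ?_)
      (fun n => Eventually.of_forall fun y => ?_) ?_ ?_
    · have := (hψ n).continuous_gradMat
      have h : Continuous fun y => g (gradMat (ψ n) y) := hg.comp this
      exact h.measurable.coe_nnreal_ennreal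
    · exact ENNReal.coe_le_coe.2 (hC _ (hψb n y))
    · simp [volume_unitCube]
    · refine ae_restrict_of_ae ?_
      filter_upwards [hψt] with y hy
      exact ENNReal.tendsto_coe.2 ((hg.tendsto _).comp hy)
  -- The added term bounds the energy on the shell between the unit cube and the cube of side `s n`,
  -- where `g` is at most `C` because mollification preserves the gradient bound.
  have h2 : Tendsto (fun n => (∫⁻ y in unitCube d, (g (gradMat (ψ n) y) : ℝ≥0∞)) +
      C * ENNReal.ofReal (s n ^ d - 1)) atTop
      (𝓝 (∫⁻ y in unitCube d, (g (G y) : ℝ≥0∞))) := by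
    have h3 : Tendsto (fun n => C * ENNReal.ofReal (s n ^ d - 1)) atTop (𝓝 0) := by
      have h4 : Tendsto (fun n => s n ^ d - 1) atTop (𝓝 0) := by
        simpa using (hs.pow d).sub_const 1
      have h5 := ENNReal.Tendsto.const_mul (a := (C : ℝ≥0∞)) (ENNReal.tendsto_ofReal h4)
        (Or.inr ENNReal.coe_ne_top)
      simpa using h5
    simpa using h1.add h3
  obtain ⟨n, hn⟩ := (h2.eventually_lt_const hT).exists
  have hs0 : 0 < s n := one_pos.trans (hs1 n)
  -- Shrinking back to the unit cube leaves gradient values unchanged and divides the energy by `s n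
  -- ^ d ≥ 1`.
  obtain ⟨χ, hχ, -, hχg⟩ := (hψ n).unscale hs0
  refine ⟨χ, hχ, lt_of_le_of_lt ?_ hn⟩
  have h6 : ∫⁻ y in unitCube d, (g (gradMat χ y) : ℝ≥0∞) ≤
      ∫⁻ y in cube 0 (s n), (g (gradMat (ψ n) y) : ℝ≥0∞) := by
    rw [lintegral_cube_eq 0 hs0]
    simp only [hχg]
    refine le_mul_of_one_le_left zero_le ?_
    rw [ENNReal.one_le_ofReal]
    exact one_le_pow₀ (hs1 n).le
  refine h6.trans ?_
  have hsub : unitCube d ⊆ cube 0 (s n) := cube_mono 0 (hs1 n).le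
  have hm1 : MeasurableSet (unitCube d) := measurableSet_cube 0 1
  rw [← Set.union_sdiff_cancel hsub]
  refine (lintegral_union_le _ _ _).trans (add_le_add le_rfl ?_)
  refine (setLIntegral_mono' ((measurableSet_cube 0 (s n)).diff hm1)
    (g := fun _ => (C : ℝ≥0∞)) fun y _ => ?_).trans ?_
  · exact_mod_cast hC _ (hψb n y)
  · rw [setLIntegral_const, measure_sdiff hsub hm1.nullMeasurableSet (by simp [volume_unitCube]),
      volume_unitCube, volume_cube 0 hs0, ENNReal.ofReal_sub _ zero_le_one, ENNReal.ofReal_one]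

end Mollification

/-! ### Reduction of `W^{1,∞}_0` and Lipschitz competitors to test maps. -/

section BoundedGradient

variable {m d : ℕ}

/-- The limit passage in an integration by parts formula. -/
theorem tendsto_integral_mul_of_tendsto_eLpNorm {α : Type*} [MeasurableSpace α] {μ : Measure α}
    {f : ℕ → α → ℝ} {g h : α → ℝ} (hf : ∀ n, Integrable (f n) μ) (hg : Integrable g μ)
    (hh : AEStronglyMeasurable h μ) {C : ℝ} (hC : ∀ y, ‖h y‖ ≤ C)
    (hlim : Tendsto (fun n => eLpNorm (fun y => f n y - g y) 1 μ) atTop (𝓝 0)) :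
    Tendsto (fun n => ∫ y, f n y * h y ∂μ) atTop (𝓝 (∫ y, g y * h y ∂μ)) := by
  have hbd : ∀ᵐ y ∂μ, ‖h y‖ ≤ C := Eventually.of_forall hC
  refine tendsto_integral_of_L1 _ (hg.mul_bdd hh hbd).1
    (Eventually.of_forall fun n => (hf n).mul_bdd hh hbd) ?_
  have h0 := ENNReal.Tendsto.const_mul (a := ENNReal.ofReal C) hlim (Or.inr ENNReal.ofReal_ne_top)
  rw [mul_zero] at h0
  refine tendsto_of_tendsto_of_tendsto_of_le_of_le tendsto_const_nhds h0
    (fun _ => zero_le) fun n => ?_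
  rw [eLpNorm_one_eq_lintegral_enorm, ← lintegral_const_mul' _ _ ENNReal.ofReal_ne_top]
  refine lintegral_mono fun y => ?_
  rw [← sub_mul, enorm_mul, mul_comm]
  gcongr
  rw [← ofReal_norm]
  exact ENNReal.ofReal_le_ofReal (hC y)

/-- Extension by zero is weakly differentiable in the whole space: test maps satisfy the integration
by parts against any `η`, even one not supported in the cube, and `W^{1,1}` convergence passes it to
the limit. Membership in `W^{1,∞}` gives the gradient bound that mollification requires. -/
theorem exists_testFunction_of_memW10Infty
    {φ : EuclideanSpace ℝ (Fin d) → EuclideanSpace ℝ (Fin m)}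
    {G : EuclideanSpace ℝ (Fin d) → Matrix (Fin m) (Fin d) ℝ}
    (h : MemW10Infty (unitCube d) φ G)
    {g : (Fin m → Fin d → ℝ) → ℝ≥0} (hg : Continuous g) {T : ℝ≥0∞}
    (hT : ∫⁻ y in unitCube d, (g (G y) : ℝ≥0∞) < T) :
    ∃ ψ : EuclideanSpace ℝ (Fin d) → EuclideanSpace ℝ (Fin m), IsTestFunction (unitCube d) ψ ∧
      ∫⁻ y in unitCube d, (g (gradMat ψ y) : ℝ≥0∞) < T := by
  have hm1 : MeasurableSet (unitCube d) := measurableSet_cube 0 1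
  let φ' := (unitCube d).indicator φ
  let G' : EuclideanSpace ℝ (Fin d) → Fin m → Fin d → ℝ := (unitCube d).indicator G
  have hG'in : ∀ y ∈ unitCube d, G' y = G y := fun y hy => Set.indicator_of_mem hy _
  have hG'out : ∀ y ∉ unitCube d, G' y = 0 := fun y hy => Set.indicator_of_notMem hy _
  have hφ'c : ∀ i, (fun y => φ' y i) = (unitCube d).indicator fun y => φ y i := by
    intro i; ext y
    by_cases hy : y ∈ unitCube d <;> simp [φ', hy]
  have hG'c : ∀ i j, (fun y => G' y i j) = (unitCube d).indicator fun y => G y i j := by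
    intro i j; ext y
    by_cases hy : y ∈ unitCube d
    · simp [hG'in y hy, hy]
    · simp [hG'out y hy, hy]
  have hφi : ∀ i, IntegrableOn (fun y => φ y i) (unitCube d) := fun i =>
    memLp_one_iff_integrable.1 (h.memW10.memW1.memLp i)
  have hGi : ∀ i j, IntegrableOn (fun y => G y i j) (unitCube d) := fun i j =>
    memLp_one_iff_integrable.1 (h.memW10.memW1.memLp_grad i j)
  have hφ : ∀ i, LocallyIntegrable fun y => φ' y i := fun i => by
    rw [hφ'c]; exact ((integrable_indicator_iff hm1).2 (hφi i)).locallyIntegrable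
  have hG : ∀ i j, LocallyIntegrable fun y => G' y i j := fun i j => by
    rw [hG'c]; exact ((integrable_indicator_iff hm1).2 (hGi i j)).locallyIntegrable
  have hb : ∀ i j, ∃ C : ℝ, 0 ≤ C ∧ ∀ᵐ y, |G' y i j| ≤ C := by
    intro i j
    refine ⟨(eLpNorm (fun y => G y i j) ∞ (volume.restrict (unitCube d))).toReal,
      ENNReal.toReal_nonneg, ?_⟩
    have h1 := ae_le_eLpNormEssSup (f := fun y => G y i j) (μ := volume.restrict (unitCube d))
    filter_upwards [(ae_restrict_iff' hm1).1 h1] with y hy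
    by_cases hyY : y ∈ unitCube d
    · have h2 := ENNReal.toReal_mono (h.memW1.memLp_grad i j).eLpNorm_lt_top.ne
        (eLpNorm_exponent_top (f := fun y => G y i j) ▸ hy hyY)
      rw [hG'in y hyY]
      simpa only [toReal_enorm, Real.norm_eq_abs] using h2
    · simp [hG'out y hyY]
  choose C hC0 hC using hb
  have hGb : ∀ᵐ y, ‖G' y‖ ≤ ∑ i, ∑ j, C i j := by
    filter_upwards [ae_all_iff.2 fun i => ae_all_iff.2 (hC i)] with y hy
    have h0 : 0 ≤ ∑ i, ∑ j, C i j := Finset.sum_nonneg fun i _ => Finset.sum_nonneg fun j _ => hC0 i j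
    rw [pi_norm_le_iff_of_nonneg h0]
    intro i
    rw [pi_norm_le_iff_of_nonneg h0]
    intro j
    refine (hy i j).trans ?_
    refine (Finset.single_le_sum (f := fun j => C i j) (fun j _ => hC0 i j)
      (Finset.mem_univ j)).trans ?_
    exact Finset.single_le_sum (f := fun i => ∑ j, C i j)
      (fun i _ => Finset.sum_nonneg fun j _ => hC0 i j) (Finset.mem_univ i)
  refine exists_testFunction_lintegral_lt (φ := φ') (G := G')
    (Finset.sum_nonneg fun i _ => Finset.sum_nonneg fun j _ => hC0 i j) hφ
    (fun y hy => by simp [φ', hy]) hG hGb (fun i j η hη => ?_) hg ?_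
  · obtain ⟨ψ, hψ, hψ1, hψ2⟩ := h.memW10.approx
    have e1 : ∫ y, φ' y i * partialDeriv j η y =
        ∫ y in unitCube d, φ y i * partialDeriv j η y := by
      rw [← integral_indicator hm1]
      refine integral_congr_ae (Eventually.of_forall fun y => ?_)
      by_cases hy : y ∈ unitCube d <;> simp [φ', hy]
    have e2 : ∫ y, G' y i j * η y = ∫ y in unitCube d, G y i j * η y := by
      rw [← integral_indicator hm1]
      refine integral_congr_ae (Eventually.of_forall fun y => ?_)
      by_cases hy : y ∈ unitCube d
      · simp [hG'in y hy, hy]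
      · simp [hG'out y hy, hy]
    obtain ⟨C1, hC1⟩ := (hη.continuous_partialDeriv j).bounded_above_of_compact_support
      (hη.hasCompactSupport_partialDeriv j)
    obtain ⟨C2, hC2⟩ := hη.smooth.continuous.bounded_above_of_compact_support hη.compact
    have t1 := tendsto_integral_mul_of_tendsto_eLpNorm
      (fun n => memLp_one_iff_integrable.1 (((hψ n).memW1 1).memLp i)) (hφi i)
      (hη.continuous_partialDeriv j).aestronglyMeasurable hC1 (hψ1 i)
    have t2 := tendsto_integral_mul_of_tendsto_eLpNorm
      (fun n => memLp_one_iff_integrable.1 (((hψ n).memW1 1).memLp_grad i j)) (hGi i j)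
      hη.smooth.continuous.aestronglyMeasurable hC2 (hψ2 i j)
    rw [e1, e2]
    refine tendsto_nhds_unique t1 (t2.neg.congr fun n => ?_)
    rw [setIntegral_eq_integral_of_forall_compl_eq_zero,
      setIntegral_eq_integral_of_forall_compl_eq_zero,
      integral_mul_partialDeriv ((hψ n).component i) hη j]
    · rfl
    · intro y hy; simp [((hψ n).component i).eq_zero hy]
    · intro y hy
      have := ((hψ n).component i).partialDeriv_eq_zero hy j
      simp [gradMat, this]
  · refine lt_of_le_of_lt (le_of_eq ?_) hT
    refine setLIntegral_congr_fun hm1 fun y hy => ?_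
    rw [hG'in y hy]

theorem norm_partialDeriv_le_of_lipschitzWith {w : EuclideanSpace ℝ (Fin d) → ℝ} {K : ℝ≥0}
    (hw : LipschitzWith K w) (j : Fin d) (y : EuclideanSpace ℝ (Fin d)) :
    |partialDeriv j w y| ≤ K := by
  refine ((fderiv ℝ w y).le_opNorm _).trans ?_
  simpa using norm_fderiv_le_of_lipschitz ℝ hw (x₀ := y)

theorem measurable_partialDeriv (w : EuclideanSpace ℝ (Fin d) → ℝ) (j : Fin d) :
    Measurable (partialDeriv j w) :=
  measurable_fderiv_apply_const ℝ w _

theorem norm_gradMat_le_of_lipschitzWith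
    {w : EuclideanSpace ℝ (Fin d) → EuclideanSpace ℝ (Fin m)} {K : ℝ≥0}
    (hw : ∀ i, LipschitzWith K fun y => w y i) (y : EuclideanSpace ℝ (Fin d)) :
    ‖gradMat w y‖ ≤ K := by
  rw [pi_norm_le_iff_of_nonneg K.coe_nonneg]
  intro i
  rw [pi_norm_le_iff_of_nonneg K.coe_nonneg]
  intro j
  exact norm_partialDeriv_le_of_lipschitzWith (hw i) j y

theorem measurable_gradMat (w : EuclideanSpace ℝ (Fin d) → EuclideanSpace ℝ (Fin m)) :
    Measurable (gradMat w) :=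
  measurable_pi_iff.2 fun _ => measurable_pi_iff.2 fun _ => measurable_partialDeriv _ _

/-- By Rademacher's theorem the classical gradient of a Lipschitz map exists almost everywhere and
is its weak gradient. This makes truncated maps admissible in the frozen problem. -/
theorem exists_testFunction_of_lipschitzWith
    {w : EuclideanSpace ℝ (Fin d) → EuclideanSpace ℝ (Fin m)} {K : ℝ≥0}
    (hw : ∀ i, LipschitzWith K fun y => w y i) (hw0 : ∀ y ∉ unitCube d, w y = 0)
    {g : (Fin m → Fin d → ℝ) → ℝ≥0} (hg : Continuous g) {T : ℝ≥0∞}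
    (hT : ∫⁻ y in unitCube d, (g (gradMat w y) : ℝ≥0∞) < T) :
    ∃ ψ : EuclideanSpace ℝ (Fin d) → EuclideanSpace ℝ (Fin m), IsTestFunction (unitCube d) ψ ∧
      ∫⁻ y in unitCube d, (g (gradMat ψ y) : ℝ≥0∞) < T := by
  refine exists_testFunction_lintegral_lt K.2 (fun i => (hw i).continuous.locallyIntegrable) hw0
    (fun i j => ?_) (Eventually.of_forall (norm_gradMat_le_of_lipschitzWith hw))
    (fun i j η hη => ?_) hg hT
  · refine (locallyIntegrable_const (K : ℝ)).mono
      (measurable_partialDeriv _ j).aestronglyMeasurable (Eventually.of_forall fun y => ?_)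
    rw [Real.norm_of_nonneg K.coe_nonneg]
    exact norm_partialDeriv_le_of_lipschitzWith (hw i) j y
  · obtain ⟨D, hD⟩ := hη.smooth.lipschitzWith_of_hasCompactSupport hη.compact (by simp)
    have h := (hw i).integral_lineDeriv_mul_eq (μ := volume) hD hη.compact
      (EuclideanSpace.single j 1)
    have e1 : ∫ y, gradMat w y i j * η y =
        ∫ y, lineDeriv ℝ (fun y => w y i) y (EuclideanSpace.single j 1) * η y := by
      refine integral_congr_ae ?_
      filter_upwards [(hw i).ae_differentiableAt (μ := volume)] with y hy
      rw [hy.lineDeriv_eq_fderiv]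
      rfl
    rw [e1, h, ← integral_neg]
    refine integral_congr_ae (Eventually.of_forall fun y => ?_)
    beta_reduce
    rw [(hη.differentiable y).lineDeriv_eq_fderiv, partialDeriv, map_neg]
    ring

end BoundedGradient

/-! ### Maximal function and choice of a good dyadic level. -/

section WeakType

variable {d : ℕ}

/-- The set where the maximal function of `g` exceeds `t`. -/
def maximalSet (g : EuclideanSpace ℝ (Fin d) → ℝ≥0∞) (t : ℝ≥0∞) :
    Set (EuclideanSpace ℝ (Fin d)) :=
  {x | ∃ r : ℝ, 0 < r ∧
    t * volume (Metric.closedBall x r) < ∫⁻ y in Metric.closedBall x r, g y}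

theorem volume_closedBall_mul (x y : EuclideanSpace ℝ (Fin d)) {κ r : ℝ} (hκ : 0 ≤ κ)
    (hr : 0 ≤ r) : volume (Metric.closedBall x (κ * r)) =
      ENNReal.ofReal (κ ^ d) * volume (Metric.closedBall y r) := by
  rw [Measure.addHaar_closedBall _ _ (mul_nonneg hκ hr), Measure.addHaar_closedBall _ _ hr]
  simp only [finrank_euclideanSpace, Fintype.card_fin, mul_pow]
  rw [ENNReal.ofReal_mul (pow_nonneg hκ _), mul_assoc]

/-- The weak type (1,1) inequality for the maximal function. -/
theorem mul_volume_maximalSet_le (hd : 1 ≤ d) (g : EuclideanSpace ℝ (Fin d) → ℝ≥0∞) {t : ℝ≥0∞}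
    (ht : t ≠ 0) (ht' : t ≠ ⊤) :
    t * volume (maximalSet g t) ≤ ENNReal.ofReal (5 ^ d) * ∫⁻ y, g y := by
  by_cases hI : ∫⁻ y, g y = ⊤
  · rw [hI, ENNReal.mul_top (by simp)]; exact le_top
  choose! r hr0 hr using show ∀ x ∈ maximalSet g t, ∃ r : ℝ, 0 < r ∧
    t * volume (Metric.closedBall x r) < ∫⁻ y in Metric.closedBall x r, g y from fun x hx => hx
  let c := volume (Metric.closedBall (0 : EuclideanSpace ℝ (Fin d)) 1)
  have hc : c ≠ 0 := (Metric.measure_closedBall_pos _ _ one_pos).ne'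
  have hc' : c ≠ ⊤ := measure_closedBall_lt_top.ne
  -- Vitali's covering lemma needs bounded radii. A radius above 1 satisfies `r ≤ r ^ d`, as `d ≥
  -- 1`, and `t * c * r ^ d` is at most the total integral.
  have hbound : ∀ x ∈ maximalSet g t, r x ≤ max 1 ((∫⁻ y, g y) / (t * c)).toReal := by
    intro x hx
    by_cases h1 : r x ≤ 1
    · exact h1.trans (le_max_left _ _)
    push Not at h1
    refine le_trans ?_ (le_max_right _ _)
    have h2 := (hr x hx).trans_le (setLIntegral_le_lintegral _ _)
    have h3 := volume_closedBall_mul x 0 (hr0 x hx).le zero_le_one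
    rw [mul_one] at h3
    rw [h3] at h2
    have h4 : ENNReal.ofReal (r x ^ d) ≤ (∫⁻ y, g y) / (t * c) := by
      rw [ENNReal.le_div_iff_mul_le (Or.inl (mul_ne_zero ht hc))
        (Or.inl (ENNReal.mul_ne_top ht' hc'))]
      refine le_of_eq_of_le ?_ h2.le
      ring
    have h5 := ENNReal.toReal_mono
      (ENNReal.div_ne_top hI (mul_ne_zero ht hc)) h4
    rw [ENNReal.toReal_ofReal (pow_nonneg (hr0 x hx).le _)] at h5
    exact (le_self_pow₀ h1.le (by omega)).trans h5
  obtain ⟨u, hu, hdisj, hcov⟩ := Vitali.exists_disjoint_subfamily_covering_enlargement_closedBall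
    (maximalSet g t) (fun x => x) r _ hbound 5 (by norm_num)
  have hcount : u.Countable := by
    refine hdisj.countable_of_nonempty_interior fun x hx => ?_
    exact ⟨x, Metric.ball_subset_interior_closedBall (Metric.mem_ball_self (hr0 x (hu hx)))⟩
  have hsub : maximalSet g t ⊆ ⋃ b ∈ u, Metric.closedBall b (5 * r b) := by
    intro x hx
    obtain ⟨b, hb, hb'⟩ := hcov x hx
    exact Set.mem_biUnion hb (hb' (Metric.mem_closedBall_self (hr0 x hx).le))
  have := hcount.to_subtype
  calc t * volume (maximalSet g t)
      ≤ t * ∑' b : u, volume (Metric.closedBall (b : EuclideanSpace ℝ (Fin d)) (5 * r b)) := by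
        gcongr
        exact (measure_mono hsub).trans (measure_biUnion_le _ hcount _)
    _ = ENNReal.ofReal (5 ^ d) *
        ∑' b : u, t * volume (Metric.closedBall (b : EuclideanSpace ℝ (Fin d)) (r b)) := by
        rw [ENNReal.tsum_mul_left, ← mul_assoc, mul_comm (ENNReal.ofReal _), mul_assoc,
          ← ENNReal.tsum_mul_left (a := ENNReal.ofReal _)]
        congr 2
        ext b
        exact volume_closedBall_mul _ _ (by norm_num) (hr0 b (hu b.2)).le
    _ ≤ ENNReal.ofReal (5 ^ d) *
        ∑' b : u, ∫⁻ y in Metric.closedBall (b : EuclideanSpace ℝ (Fin d)) (r b), g y := by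
        gcongr with b
        exact (hr b (hu b.2)).le
    _ = ENNReal.ofReal (5 ^ d) * ∫⁻ y in ⋃ b ∈ u, Metric.closedBall b (r b), g y := by
        rw [lintegral_biUnion hcount (fun b _ => Metric.isClosed_closedBall.measurableSet) hdisj]
    _ ≤ ENNReal.ofReal (5 ^ d) * ∫⁻ y, g y := by
        gcongr
        exact Measure.restrict_le_self

/-- The part of `g` below `t / 2` contributes at most `t / 2` to any average, so an average above
`t` forces the part of `g` above `t / 2` to have average above `t / 2`. Keeping only large values on
the right is what makes the sum over levels converge. -/
theorem mul_volume_maximalSet_le_setLIntegral (hd : 1 ≤ d)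
    (g : EuclideanSpace ℝ (Fin d) → ℝ≥0) {t : ℝ≥0} (ht : t ≠ 0) :
    t * volume (maximalSet (fun y => g y) t) ≤
      2 * ENNReal.ofReal (5 ^ d) * ∫⁻ y, if t < 2 * g y then (g y : ℝ≥0∞) else 0 := by
  let g' : EuclideanSpace ℝ (Fin d) → ℝ≥0∞ := fun y => if t < 2 * g y then (g y : ℝ≥0∞) else 0
  have hle : ∀ y, (g y : ℝ≥0∞) ≤ g' y + ((t / 2 : ℝ≥0) : ℝ≥0∞) := by
    intro y
    by_cases h : t < 2 * g y
    · simp [g', h]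
    · simp only [g', h, if_false, zero_add, ENNReal.coe_le_coe]
      rw [not_lt] at h
      rw [le_div_iff₀ two_pos, mul_comm]
      exact h
  have hsub : maximalSet (fun y => (g y : ℝ≥0∞)) t ⊆ maximalSet g' ((t / 2 : ℝ≥0) : ℝ≥0∞) := by
    rintro x ⟨r, hr, hx⟩
    refine ⟨r, hr, ?_⟩
    have h1 := hx.trans_le (lintegral_mono hle)
    rw [lintegral_add_right _ measurable_const, setLIntegral_const] at h1
    have h2 : (t : ℝ≥0∞) = ((t / 2 : ℝ≥0) : ℝ≥0∞) + ((t / 2 : ℝ≥0) : ℝ≥0∞) := by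
      rw [← ENNReal.coe_add, add_halves]
    rw [h2, add_mul] at h1
    exact lt_of_add_lt_add_right h1
  have h3 := mul_volume_maximalSet_le hd g' (t := ((t / 2 : ℝ≥0) : ℝ≥0∞))
    (by simpa using ht) ENNReal.coe_ne_top
  calc (t : ℝ≥0∞) * volume (maximalSet (fun y => (g y : ℝ≥0∞)) t)
      = 2 * (((t / 2 : ℝ≥0) : ℝ≥0∞) * volume (maximalSet (fun y => (g y : ℝ≥0∞)) t)) := by
        rw [← mul_assoc]
        congr 1
        rw [← ENNReal.coe_ofNat, ← ENNReal.coe_mul, mul_div_cancel₀ _ two_ne_zero]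
    _ ≤ 2 * (((t / 2 : ℝ≥0) : ℝ≥0∞) * volume (maximalSet g' ((t / 2 : ℝ≥0) : ℝ≥0∞))) := by
        gcongr
    _ ≤ _ := by
        rw [mul_assoc]
        gcongr

/-- A geometric sum of ratio `q = 2 ^ (p - 1) > 1` is controlled by its last active term, hence the
constant `q / (q - 1)`, uniform in `N`. Here `p > 1` is essential: for `p = 1` the sum counts levels
and grows like `log t`. -/
theorem sum_ite_two_pow_rpow_le {p : ℝ} (hp : 1 < p) : ∃ C : ℝ≥0, ∀ (N : ℕ) (t : ℝ≥0),
    ∑ k ∈ Finset.range N, (if (2 : ℝ≥0) ^ k < t then ((2 : ℝ≥0) ^ k) ^ (p - 1) else 0) ≤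
      C * t ^ (p - 1) := by
  have hp' : 0 < p - 1 := sub_pos.2 hp
  let q : ℝ := (2 : ℝ) ^ (p - 1)
  have hq : 1 < q := Real.one_lt_rpow one_lt_two hp'
  have hq1 : 0 < q - 1 := sub_pos.2 hq
  have hqk : ∀ k : ℕ, ((2 : ℝ) ^ k) ^ (p - 1) = q ^ k := fun k => by
    rw [← Real.rpow_natCast_mul (by norm_num), mul_comm, Real.rpow_mul_natCast (by norm_num)]
  refine ⟨(q / (q - 1)).toNNReal, fun N t => ?_⟩
  induction N with
  | zero => simp
  | succ N ih =>
    by_cases h : (2 : ℝ≥0) ^ N < t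
    · have h1 : ∑ k ∈ Finset.range (N + 1),
          (if (2 : ℝ≥0) ^ k < t then ((2 : ℝ≥0) ^ k) ^ (p - 1) else 0) ≤
          ∑ k ∈ Finset.range (N + 1), ((2 : ℝ≥0) ^ k) ^ (p - 1) :=
        Finset.sum_le_sum fun k _ => by split_ifs <;> simp
      refine h1.trans ?_
      rw [← NNReal.coe_le_coe]
      push_cast
      simp only [hqk]
      rw [Real.coe_toNNReal _ (by positivity), geom_sum_eq hq.ne', div_le_iff₀ hq1]
      have h2 : q ^ N ≤ (t : ℝ) ^ (p - 1) := by
        rw [← hqk]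
        refine Real.rpow_le_rpow (by positivity) ?_ hp'.le
        exact_mod_cast h.le
      have h3 : q / (q - 1) * (t : ℝ) ^ (p - 1) * (q - 1) = q * (t : ℝ) ^ (p - 1) := by
        field_simp
      rw [h3, pow_succ]
      nlinarith [one_pos.trans hq]
    · rw [Finset.sum_range_succ, if_neg h, add_zero]
      exact ih

/-- Among `N` dyadic levels, there is one at which the maximal function of an `L^p` function
satisfies a weak estimate improved by the factor `N`. -/
theorem exists_level_maximalSet (hd : 1 ≤ d) {p : ℝ} (hp : 1 < p) :
    ∃ C : ℝ≥0, ∀ g : EuclideanSpace ℝ (Fin d) → ℝ≥0, Measurable g → ∀ N : ℕ, 0 < N →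
      ∃ k < N, (N : ℝ≥0∞) * ((((2 : ℝ≥0) ^ k) ^ p : ℝ≥0) *
        volume (maximalSet (fun y => g y) ((2 : ℝ≥0) ^ k : ℝ≥0))) ≤
        C * ∫⁻ y, ((g y ^ p : ℝ≥0) : ℝ≥0∞) := by
  obtain ⟨C, hC⟩ := sum_ite_two_pow_rpow_le hp
  refine ⟨2 * Real.toNNReal (5 ^ d) * (C * 2 ^ (p - 1)), fun g hg N hN => ?_⟩
  let A : ℕ → ℝ≥0∞ := fun k => (((2 : ℝ≥0) ^ k) ^ p : ℝ≥0) *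
        volume (maximalSet (fun y => g y) ((2 : ℝ≥0) ^ k : ℝ≥0))
  -- The weak estimate at level `2 ^ k` is multiplied by `2 ^ (k * (p - 1))`. Summed under the
  -- integral with `t = 2 * g y`, the weights give a multiple of `g y ^ (p - 1) * g y`.
  have hA : ∀ k, A k ≤ 2 * ENNReal.ofReal (5 ^ d) * ∫⁻ y,
      (((if (2 : ℝ≥0) ^ k < 2 * g y then ((2 : ℝ≥0) ^ k) ^ (p - 1) else 0) * g y : ℝ≥0) : ℝ≥0∞) := by
    intro k
    have h0 : (2 : ℝ≥0) ^ k ≠ 0 := by positivity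
    have h1 : ((2 : ℝ≥0) ^ k) ^ p = ((2 : ℝ≥0) ^ k) ^ (p - 1) * 2 ^ k := by
      rw [← NNReal.rpow_add_one h0, sub_add_cancel]
    have h2 := mul_volume_maximalSet_le_setLIntegral hd g h0
    calc A k = ((((2 : ℝ≥0) ^ k) ^ (p - 1) : ℝ≥0) : ℝ≥0∞) * (((2 : ℝ≥0) ^ k : ℝ≥0) *
        volume (maximalSet (fun y => g y) ((2 : ℝ≥0) ^ k : ℝ≥0))) := by
          simp only [A]
          rw [h1, ENNReal.coe_mul, mul_assoc]
      _ ≤ ((((2 : ℝ≥0) ^ k) ^ (p - 1) : ℝ≥0) : ℝ≥0∞) * (2 * ENNReal.ofReal (5 ^ d) *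
          ∫⁻ y, if (2 : ℝ≥0) ^ k < 2 * g y then (g y : ℝ≥0∞) else 0) := by gcongr
      _ = _ := by
          rw [mul_left_comm]
          rw [← lintegral_const_mul' _ _ ENNReal.coe_ne_top]
          congr 2
          ext y
          split_ifs <;> simp
  have hsum : ∑ k ∈ Finset.range N, A k ≤
      ((2 * Real.toNNReal (5 ^ d) * (C * 2 ^ (p - 1)) : ℝ≥0) : ℝ≥0∞) *
        ∫⁻ y, ((g y ^ p : ℝ≥0) : ℝ≥0∞) := by
    refine (Finset.sum_le_sum fun k _ => hA k).trans ?_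
    rw [← Finset.mul_sum]
    refine le_of_le_of_eq (b := 2 * ENNReal.ofReal (5 ^ d) * (((C * 2 ^ (p - 1) : ℝ≥0) : ℝ≥0∞) *
      ∫⁻ y, ((g y ^ p : ℝ≥0) : ℝ≥0∞))) ?_ ?_
    · refine mul_le_mul' le_rfl ?_
      rw [← lintegral_finsetSum]
      · rw [← lintegral_const_mul' _ _ ENNReal.coe_ne_top]
        refine lintegral_mono fun y => ?_
        rw [← ENNReal.ofNNReal_finsetSum, ← ENNReal.coe_mul, ENNReal.coe_le_coe, ← Finset.sum_mul]
        refine (mul_le_mul_left (hC N (2 * g y)) (g y)).trans (le_of_eq ?_)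
        rw [NNReal.mul_rpow]
        by_cases hgy : g y = 0
        · rw [hgy, NNReal.zero_rpow (x := p) (by linarith), mul_zero, mul_zero]
        · have h1 : g y ^ p = g y ^ (p - 1) * g y := by
            rw [← NNReal.rpow_add_one hgy, sub_add_cancel]
          rw [h1]
          ring
      · intro k _
        refine Measurable.coe_nnreal_ennreal (Measurable.mul ?_ hg)
        exact Measurable.ite (measurableSet_lt measurable_const (hg.const_mul 2))
          measurable_const measurable_const
    · rw [ENNReal.coe_mul, ENNReal.ofReal]
      simp [mul_assoc]
  have hne : (Finset.range N).Nonempty := Finset.nonempty_range_iff.2 hN.ne'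
  -- The smallest of the `N` terms is at most their average, which produces the factor `N`.
  obtain ⟨k, hk, hmin⟩ := Finset.exists_min_image (Finset.range N) A hne
  refine ⟨k, Finset.mem_range.1 hk, le_trans ?_ hsum⟩
  have := Finset.card_nsmul_le_sum (Finset.range N) A (A k) hmin
  rwa [Finset.card_range, nsmul_eq_mul] at this

end WeakType

/-! ### Lipschitz truncation of scalar functions. -/

section LipschitzTruncation

variable {d : ℕ}

/-- The increment of a `C¹` function along a segment is bounded by the integral of the gradient. -/
theorem enorm_sub_le_lintegral {f : EuclideanSpace ℝ (Fin d) → ℝ} (hf : ContDiff ℝ 1 f)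
    {g : EuclideanSpace ℝ (Fin d) → ℝ≥0} (hfg : ∀ y, ‖fderiv ℝ f y‖ ≤ g y)
    (x z : EuclideanSpace ℝ (Fin d)) :
    ‖f z - f x‖ₑ ≤ ∫⁻ t in Set.Ioc (0 : ℝ) 1, g (x + t • (z - x)) * ‖z - x‖ₑ := by
  have hd : ∀ t : ℝ, HasDerivAt (fun t : ℝ => f (x + t • (z - x)))
      (fderiv ℝ f (x + t • (z - x)) (z - x)) t := by
    intro t
    have h1 : HasDerivAt (fun t : ℝ => x + t • (z - x)) (z - x) t := by
      simpa using ((hasDerivAt_id t).smul_const (z - x)).const_add x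
    exact ((hf.differentiable one_ne_zero) (x + t • (z - x))).hasFDerivAt.comp_hasDerivAt t h1
  have hcont : Continuous fun t : ℝ => fderiv ℝ f (x + t • (z - x)) (z - x) := by
    have := hf.continuous_fderiv one_ne_zero
    fun_prop
  have h2 := intervalIntegral.integral_eq_sub_of_hasDerivAt (fun t _ => hd t)
    (hcont.intervalIntegrable 0 1)
  simp only [one_smul, add_sub_cancel, zero_smul, add_zero] at h2
  rw [← h2, intervalIntegral.integral_of_le zero_le_one]
  refine (enorm_integral_le_lintegral_enorm _).trans (lintegral_mono fun t => ?_)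
  rw [← ofReal_norm, ← ofReal_norm, ← ENNReal.ofReal_coe_nnreal,
    ← ENNReal.ofReal_mul (NNReal.coe_nonneg _)]
  refine ENNReal.ofReal_le_ofReal ((ContinuousLinearMap.le_opNorm _ _).trans ?_)
  gcongr
  exact hfg _

theorem lintegral_closedBall_le_of_notMem_maximalSet {g : EuclideanSpace ℝ (Fin d) → ℝ≥0∞}
    {l : ℝ≥0∞} {x : EuclideanSpace ℝ (Fin d)} (hx : x ∉ maximalSet g l) {r : ℝ} (hr : 0 < r) :
    ∫⁻ y in Metric.closedBall x r, g y ≤ l * volume (Metric.closedBall x r) := by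
  by_contra h
  exact hx ⟨r, hr, not_le.1 h⟩

/-- The homothety of ratio `t` centred at `x` carries the ball of radius `r` to that of radius `t *
r`; the Jacobian cancels the ratio of volumes, so the bound does not depend on `t`. This is what
lets the segment estimate be integrated over `t`. -/
theorem lintegral_closedBall_homothety_le {g : EuclideanSpace ℝ (Fin d) → ℝ≥0∞}
    {l : ℝ≥0∞} {x : EuclideanSpace ℝ (Fin d)} (hx : x ∉ maximalSet g l) {r : ℝ} (hr : 0 < r)
    {t : ℝ} (ht : 0 < t) :
    ∫⁻ z in Metric.closedBall x r, g (x + t • (z - x)) ≤ l * volume (Metric.closedBall x r) := by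
  have h1 := lintegral_closedBall_le_of_notMem_maximalSet hx (mul_pos ht hr)
  rw [volume_closedBall_mul x x ht.le hr.le,
    ← lintegral_indicator Metric.isClosed_closedBall.measurableSet,
    ← lintegral_comp_affine (x - t • x) ht, mul_left_comm] at h1
  have h2 : ENNReal.ofReal (t ^ d) ≠ 0 := by simp [ht]
  rw [ENNReal.mul_le_mul_iff_right h2 ENNReal.ofReal_ne_top] at h1
  refine le_of_eq_of_le ?_ h1
  rw [← lintegral_indicator Metric.isClosed_closedBall.measurableSet]
  congr 1
  ext z
  have e1 : x - t • x + t • z = x + t • (z - x) := by rw [smul_sub]; abel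
  have e2 : z ∈ Metric.closedBall x r ↔ x + t • (z - x) ∈ Metric.closedBall x (t * r) := by
    rw [Metric.mem_closedBall, Metric.mem_closedBall, dist_eq_norm, dist_eq_norm,
      add_sub_cancel_left, norm_smul, Real.norm_of_nonneg ht.le, mul_le_mul_iff_right₀ ht]
  rw [e1]
  by_cases hz : z ∈ Metric.closedBall x r
  · rw [Set.indicator_of_mem hz, Set.indicator_of_mem (e2.1 hz)]
  · rw [Set.indicator_of_notMem hz, Set.indicator_of_notMem (mt e2.2 hz)]

/-- Poincaré inequality centred at a point where the maximal function of the gradient is small. -/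
theorem lintegral_enorm_sub_le {f : EuclideanSpace ℝ (Fin d) → ℝ} (hf : ContDiff ℝ 1 f)
    {g : EuclideanSpace ℝ (Fin d) → ℝ≥0} (hg : Measurable g) (hfg : ∀ y, ‖fderiv ℝ f y‖ ≤ g y)
    {l : ℝ≥0∞} {x : EuclideanSpace ℝ (Fin d)} (hx : x ∉ maximalSet (fun y => g y) l) {r : ℝ}
    (hr : 0 < r) :
    ∫⁻ z in Metric.closedBall x r, ‖f z - f x‖ₑ ≤
      ENNReal.ofReal r * (l * volume (Metric.closedBall x r)) := by
  have hm : MeasurableSet (Metric.closedBall x r) := Metric.isClosed_closedBall.measurableSet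
  calc ∫⁻ z in Metric.closedBall x r, ‖f z - f x‖ₑ
      ≤ ∫⁻ z in Metric.closedBall x r, ∫⁻ t in Set.Ioc (0 : ℝ) 1,
          ENNReal.ofReal r * g (x + t • (z - x)) := by
        refine setLIntegral_mono' hm fun z hz => (enorm_sub_le_lintegral hf hfg x z).trans ?_
        refine lintegral_mono fun t => ?_
        beta_reduce
        rw [mul_comm]
        gcongr
        rw [← ofReal_norm]
        refine ENNReal.ofReal_le_ofReal ?_
        rwa [← dist_eq_norm]
    _ = ∫⁻ t in Set.Ioc (0 : ℝ) 1, ∫⁻ z in Metric.closedBall x r,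
          ENNReal.ofReal r * g (x + t • (z - x)) := by
        refine lintegral_lintegral_swap (Measurable.aemeasurable ?_)
        refine Measurable.const_mul ?_ _
        refine (hg.comp ?_).coe_nnreal_ennreal
        fun_prop
    _ ≤ ∫⁻ t in Set.Ioc (0 : ℝ) 1, ENNReal.ofReal r * (l * volume (Metric.closedBall x r)) := by
        refine setLIntegral_mono' measurableSet_Ioc fun t ht => ?_
        rw [lintegral_const_mul' _ _ ENNReal.ofReal_ne_top]
        gcongr
        exact lintegral_closedBall_homothety_le hx hr ht.1
    _ = _ := by simp

theorem lintegral_enorm_sub_le_of_subset {f : EuclideanSpace ℝ (Fin d) → ℝ}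
    (hf : ContDiff ℝ 1 f) {g : EuclideanSpace ℝ (Fin d) → ℝ≥0} (hg : Measurable g)
    (hfg : ∀ y, ‖fderiv ℝ f y‖ ≤ g y) {l : ℝ≥0∞} {x c : EuclideanSpace ℝ (Fin d)}
    (hx : x ∉ maximalSet (fun y => g y) l) {s κ : ℝ} (hs : 0 < s) (hκ : 0 < κ)
    (hsub : Metric.closedBall c s ⊆ Metric.closedBall x (κ * s)) :
    ∫⁻ z in Metric.closedBall c s, ‖f z - f x‖ₑ ≤
      ENNReal.ofReal (κ * s) * l * ENNReal.ofReal (κ ^ d) * volume (Metric.closedBall c s) := by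
  refine (lintegral_mono_set hsub).trans
    ((lintegral_enorm_sub_le hf hg hfg hx (mul_pos hκ hs)).trans (le_of_eq ?_))
  rw [volume_closedBall_mul x c hκ.le hs.le]
  ring

/-- The ball of radius `r / 2` about the midpoint lies in the balls of radius `r` about `x` and `y`.
Averaging `|f x - f y| ≤ |f z - f x| + |f z - f y|` over it gives the constant `2 * 2 ^ d`, enlarged
to match the boundary estimate below. -/
theorem abs_sub_le_of_notMem_maximalSet {f : EuclideanSpace ℝ (Fin d) → ℝ}
    (hf : ContDiff ℝ 1 f) {g : EuclideanSpace ℝ (Fin d) → ℝ≥0} (hg : Measurable g)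
    (hfg : ∀ y, ‖fderiv ℝ f y‖ ≤ g y) {l : ℝ≥0} {x y : EuclideanSpace ℝ (Fin d)}
    (hx : x ∉ maximalSet (fun y => g y) l) (hy : y ∉ maximalSet (fun y => g y) l) :
    |f x - f y| ≤ 2 * 4 ^ d * l * ‖x - y‖ := by
  rcases eq_or_ne x y with rfl | hne
  · simp
  have hr : 0 < ‖x - y‖ := norm_pos_iff.2 (sub_ne_zero.2 hne)
  set r := ‖x - y‖
  have hs : 0 < r / 2 := half_pos hr
  let c : EuclideanSpace ℝ (Fin d) := midpoint ℝ x y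
  have hcx : dist c x = r / 2 := by
    rw [dist_midpoint_left, dist_eq_norm]; simp [r]; ring
  have hcy : dist c y = r / 2 := by
    rw [dist_midpoint_right, dist_eq_norm]; simp [r]; ring
  have hsx : Metric.closedBall c (r / 2) ⊆ Metric.closedBall x (2 * (r / 2)) :=
    Metric.closedBall_subset_closedBall' (by linarith)
  have hsy : Metric.closedBall c (r / 2) ⊆ Metric.closedBall y (2 * (r / 2)) :=
    Metric.closedBall_subset_closedBall' (by linarith)
  have h1 := lintegral_enorm_sub_le_of_subset hf hg hfg hx hs two_pos hsx
  have h2 := lintegral_enorm_sub_le_of_subset hf hg hfg hy hs two_pos hsy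
  have hfm : Measurable fun z => ‖f z - f x‖ₑ :=
    (hf.continuous.measurable.sub measurable_const).enorm
  have h3 : ‖f x - f y‖ₑ * volume (Metric.closedBall c (r / 2)) ≤
      2 * (ENNReal.ofReal (2 * (r / 2)) * l * ENNReal.ofReal (2 ^ d)) *
        volume (Metric.closedBall c (r / 2)) := by
    rw [← setLIntegral_const]
    calc ∫⁻ _ in Metric.closedBall c (r / 2), ‖f x - f y‖ₑ
        ≤ ∫⁻ z in Metric.closedBall c (r / 2), (‖f z - f x‖ₑ + ‖f z - f y‖ₑ) := by
          refine lintegral_mono fun z => ?_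
          have : f x - f y = (f z - f y) - (f z - f x) := by ring
          beta_reduce
          rw [this, add_comm]
          exact enorm_sub_le
      _ = _ := lintegral_add_left hfm _
      _ ≤ _ := add_le_add h1 h2
      _ = _ := by ring
  have hv : volume (Metric.closedBall c (r / 2)) ≠ 0 :=
    (Metric.measure_closedBall_pos _ _ hs).ne'
  rw [ENNReal.mul_le_mul_iff_left hv measure_closedBall_lt_top.ne] at h3
  have h4 : |f x - f y| ≤ 2 * (2 * (r / 2) * l * 2 ^ d) := by
    have := ENNReal.toReal_mono ?_ h3
    · simpa [ENNReal.toReal_mul, ENNReal.toReal_ofReal hs.le] using this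
    · finiteness
  refine h4.trans ?_
  have h5 : (2 : ℝ) ^ d ≤ 4 ^ d := pow_le_pow_left₀ (by norm_num) (by norm_num) d
  have h6 : 2 * (2 * (r / 2) * l * 2 ^ d) = 2 * 2 ^ d * l * r := by ring
  rw [h6]
  gcongr

/-- Some coordinate hyperplane separates `y` from the cube, so a ball of radius `r / 2` centred at
distance `r / 2` from `y`, on the outer side, misses the cube. There `f` vanishes, and the ball lies
within `2 * r` of `x`, so the centred Poincaré inequality bounds `f x` itself. -/
theorem abs_le_of_notMem_maximalSet {f : EuclideanSpace ℝ (Fin d) → ℝ}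
    (hf : ContDiff ℝ 1 f) {g : EuclideanSpace ℝ (Fin d) → ℝ≥0} (hg : Measurable g)
    (hfg : ∀ y, ‖fderiv ℝ f y‖ ≤ g y) (hf0 : ∀ y ∉ unitCube d, f y = 0) {l : ℝ≥0}
    {x y : EuclideanSpace ℝ (Fin d)} (hx : x ∉ maximalSet (fun y => g y) l)
    (hy : y ∉ unitCube d) : |f x| ≤ 2 * 4 ^ d * l * ‖x - y‖ := by
  rcases eq_or_ne x y with rfl | hne
  · simp [hf0 x hy]
  have hr : 0 < ‖x - y‖ := norm_pos_iff.2 (sub_ne_zero.2 hne)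
  set r := ‖x - y‖
  have hs : 0 < r / 2 := half_pos hr
  obtain ⟨i, hi⟩ : ∃ i, 1 / 2 ≤ |y i| := by
    by_contra! h
    exact hy fun i => by simpa using h i
  obtain ⟨σ, hσ, hσy⟩ : ∃ σ : ℝ, |σ| = 1 ∧ 1 / 2 ≤ σ * y i := by
    rcases le_total 0 (y i) with h0 | h0
    · exact ⟨1, by simp, by rwa [abs_of_nonneg h0, ← one_mul (y i)] at hi⟩
    · exact ⟨-1, by simp, by rwa [abs_of_nonpos h0, ← neg_one_mul] at hi⟩
  let c : EuclideanSpace ℝ (Fin d) := y + EuclideanSpace.single i (σ * (r / 2))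
  have hcy : dist c y = r / 2 := by
    rw [dist_eq_norm]
    simp [c, hσ, abs_of_pos hr]
  have hxy : dist y x = r := by rw [dist_comm, dist_eq_norm]
  have hsx : Metric.closedBall c (r / 2) ⊆ Metric.closedBall x (4 * (r / 2)) :=
    Metric.closedBall_subset_closedBall' (by linarith [dist_triangle c y x])
  have hsc : ∀ z ∈ Metric.closedBall c (r / 2), f z = 0 := by
    intro z hz
    refine hf0 z fun hzY => ?_
    have h1 := hzY i
    simp only [PiLp.zero_apply, sub_zero] at h1
    rw [Metric.mem_closedBall, dist_eq_norm] at hz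
    have h2 : |(z - c) i| ≤ r / 2 := le_trans (by simpa using PiLp.norm_apply_le (z - c) i) hz
    have h3 : (z - c) i = z i - y i - σ * (r / 2) := by simp [c]; ring
    have h4 : σ * σ = 1 := by rw [← abs_mul_abs_self, hσ, one_mul]
    have h5 : |σ * (z - c) i| ≤ r / 2 := by rwa [abs_mul, hσ, one_mul]
    have h6 : |σ * z i| < 1 / 2 := by rwa [abs_mul, hσ, one_mul]
    have h7 : σ * (z - c) i = σ * z i - σ * y i - (r / 2) := by
      rw [h3]; linear_combination (-(r / 2)) * h4
    rw [h7] at h5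
    linarith [(abs_le.1 h5).1, (abs_lt.1 h6).2]
  have h1 := lintegral_enorm_sub_le_of_subset hf hg hfg hx hs (by norm_num : (0 : ℝ) < 4) hsx
  have h3 : ‖f x‖ₑ * volume (Metric.closedBall c (r / 2)) ≤
      ENNReal.ofReal (4 * (r / 2)) * l * ENNReal.ofReal (4 ^ d) *
        volume (Metric.closedBall c (r / 2)) := by
    rw [← setLIntegral_const]
    refine le_trans (le_of_eq ?_) h1
    refine setLIntegral_congr_fun Metric.isClosed_closedBall.measurableSet fun z hz => ?_
    simp [hsc z hz]
  have hv : volume (Metric.closedBall c (r / 2)) ≠ 0 :=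
    (Metric.measure_closedBall_pos _ _ hs).ne'
  rw [ENNReal.mul_le_mul_iff_left hv measure_closedBall_lt_top.ne] at h3
  have h4 : |f x| ≤ 4 * (r / 2) * l * 4 ^ d := by
    have := ENNReal.toReal_mono ?_ h3
    · simpa [ENNReal.toReal_mul, ENNReal.toReal_ofReal hs.le] using this
    · finiteness
  refine h4.trans (le_of_eq ?_)
  ring

/-- Lipschitz truncation of a `C¹` function vanishing outside of the unit cube. -/
theorem exists_lipschitz_truncation {f : EuclideanSpace ℝ (Fin d) → ℝ}
    (hf : ContDiff ℝ 1 f) {g : EuclideanSpace ℝ (Fin d) → ℝ≥0} (hg : Measurable g)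
    (hfg : ∀ y, ‖fderiv ℝ f y‖ ≤ g y) (hf0 : ∀ y ∉ unitCube d, f y = 0) (l : ℝ≥0) :
    ∃ w : EuclideanSpace ℝ (Fin d) → ℝ, LipschitzWith (2 * 4 ^ d * l) w ∧
      (∀ y ∉ unitCube d, w y = 0) ∧ ∀ y ∉ maximalSet (fun y => g y) l, w y = f y := by
  -- The complement of the cube is included in the set from which `f` is extended, so that the
  -- extension keeps the zero boundary values.
  have hlip : LipschitzOnWith (2 * 4 ^ d * l) f
      ((maximalSet (fun y => g y) l)ᶜ ∪ (unitCube d)ᶜ) := by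
    refine LipschitzOnWith.of_dist_le_mul fun x hx y hy => ?_
    rw [dist_eq_norm, dist_eq_norm, Real.norm_eq_abs]
    push_cast
    by_cases hxY : x ∈ unitCube d
    · have hx' := hx.resolve_right (not_not.2 hxY)
      by_cases hyY : y ∈ unitCube d
      · exact abs_sub_le_of_notMem_maximalSet hf hg hfg hx' (hy.resolve_right (not_not.2 hyY))
      · rw [hf0 y hyY, sub_zero]
        exact abs_le_of_notMem_maximalSet hf hg hfg hf0 hx' hyY
    · rw [hf0 x hxY, zero_sub, abs_neg]
      by_cases hyY : y ∈ unitCube d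
      · rw [norm_sub_rev]
        exact abs_le_of_notMem_maximalSet hf hg hfg hf0 (hy.resolve_right (not_not.2 hyY)) hxY
      · rw [hf0 y hyY, abs_zero]
        positivity
  obtain ⟨w, hw, hwf⟩ := hlip.extend_real
  refine ⟨w, hw, fun y hy => ?_, fun y hy => (hwf (Or.inl hy)).symm⟩
  rw [← hwf (Or.inr hy), hf0 y hy]

/-- The derivatives of two functions agree almost everywhere on their coincidence set. -/
theorem ae_fderiv_eq_of_eq {u w : EuclideanSpace ℝ (Fin d) → ℝ} (hu : Continuous u)
    (hw : Continuous w) (hud : ∀ᵐ y, DifferentiableAt ℝ u y) (hwd : ∀ᵐ y, DifferentiableAt ℝ w y) :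
    ∀ᵐ y, u y = w y → fderiv ℝ u y = fderiv ℝ w y := by
  rcases subsingleton_or_nontrivial (EuclideanSpace ℝ (Fin d)) with hE | hE
  · exact Eventually.of_forall fun y _ => Subsingleton.elim _ _
  obtain ⟨e, he⟩ := exists_ne (0 : EuclideanSpace ℝ (Fin d))
  let s : Set (EuclideanSpace ℝ (Fin d)) :=
    {y | u y = w y} ∩ ({y | DifferentiableAt ℝ u y} ∩ {y | DifferentiableAt ℝ w y})
  have hs : MeasurableSet s := (isClosed_eq hu hw).measurableSet.inter
    ((measurableSet_of_differentiableAt ℝ u).inter (measurableSet_of_differentiableAt ℝ w))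
  -- On the coincidence set `F` is constant, hence approximated by the zero map with constant 0, and
  -- its derivative vanishes almost everywhere there. The vector `e` only turns the scalar
  -- difference into a self-map of the space.
  let F : EuclideanSpace ℝ (Fin d) → EuclideanSpace ℝ (Fin d) := fun y => (u y - w y) • e
  have hF : ApproximatesLinearOn F (0 : _ →L[ℝ] EuclideanSpace ℝ (Fin d)) s 0 := by
    intro y hy z hz
    have h1 : u y = w y := hy.1
    have h2 : u z = w z := hz.1
    simp [F, h1, h2]
  have h := hF.norm_fderiv_sub_le volume hs
    (fun y => (fderiv ℝ u y - fderiv ℝ w y).smulRight e) fun y hy =>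
      ((hy.2.1.hasFDerivAt.sub hy.2.2.hasFDerivAt).smul_const e).hasFDerivWithinAt
  filter_upwards [(ae_restrict_iff' hs).1 h, hud, hwd] with y hy h1 h2 h3
  have h4 := hy ⟨h3, h1, h2⟩
  rw [sub_zero, nonpos_iff_eq_zero, nnnorm_eq_zero] at h4
  ext z
  have h5 := DFunLike.congr_fun h4 z
  simp only [ContinuousLinearMap.smulRight_apply, zero_apply, smul_eq_zero,
    he, or_false] at h5
  simpa [sub_eq_zero] using h5

end LipschitzTruncation

/-! ### Density of test maps in the cell problem. -/

section Approximation

/-- Energies of `p`-growth do not increase in the limit along an approximating sequence in `L^p`. -/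
theorem IsRegularIntegrand.exists_lintegral_lt {E W : Type*} [MeasurableSpace E]
    [NormedAddCommGroup W] [MeasurableSpace W] [BorelSpace W] [SecondCountableTopology W]
    {μ ν : Measure E} (hμν : μ ≤ ν) {p : ℝ} (hp : 1 ≤ p) {a : E → ℝ} {f : E → W → ℝ≥0}
    (hf : IsRegularIntegrand ν p a f) {u : E → W} {un : ℕ → E → W}
    (hun : ∀ n, Measurable (un n)) (hu : MemLp u (ENNReal.ofReal p) μ)
    (hlim : Tendsto (fun n => eLpNorm (un n - u) (ENNReal.ofReal p) μ) atTop (𝓝 0))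
    {T : ℝ≥0∞} (hT : ∫⁻ y, (f y (u y) : ℝ≥0∞) ∂μ < T) :
    ∃ n, ∫⁻ y, (f y (un n y) : ℝ≥0∞) ∂μ < T := by
  have hp0 : 0 < p := one_pos.trans_le hp
  have hpe : ENNReal.ofReal p ≠ 0 := by simpa using hp0
  obtain ⟨c, hc, hup⟩ := hf.upper
  obtain ⟨ns, hns, hae⟩ := (tendstoInMeasure_of_tendsto_eLpNorm hpe
    (fun n => (hun n).aestronglyMeasurable) hu.1 hlim).exists_seq_tendsto_ae
  let C : ℝ≥0∞ := ENNReal.ofReal (c * 2 ^ (p - 1))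
  let g : E → ℝ≥0∞ := fun y => ENNReal.ofReal (a y) + C * ‖u y‖ₑ ^ p
  have h2p : 1 ≤ (2 : ℝ) ^ (p - 1) := Real.one_le_rpow one_le_two (by linarith)
  have hint : ∀ {v : E → W}, ∫⁻ y, ‖v y‖ₑ ^ p ∂μ = eLpNorm v (ENNReal.ofReal p) μ ^ p := by
    intro v
    rw [eLpNorm_eq_lintegral_rpow_enorm_toReal hpe ENNReal.ofReal_ne_top,
      ENNReal.toReal_ofReal hp0.le, one_div, ENNReal.rpow_inv_rpow hp0.ne']
  have hofR : ∀ w : W, ‖w‖ₑ ^ p = ENNReal.ofReal (‖w‖ ^ p) := fun w => by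
    rw [← ofReal_norm, ENNReal.ofReal_rpow_of_nonneg (norm_nonneg _) hp0.le]
  have hCnn : 0 ≤ c * 2 ^ (p - 1) := by positivity
  -- The energy is split into its truncation by the fixed integrable `g`, which converges by
  -- domination along an almost everywhere convergent subsequence, and an excess controlled by the
  -- `L^p` distance.
  have hbound : ∀ y w, (f y w : ℝ≥0∞) ≤ g y + C * ‖w - u y‖ₑ ^ p := by
    intro y w
    have ha := hf.nonneg y
    simp only [g, C, hofR]
    rw [← ENNReal.ofReal_mul hCnn, ← ENNReal.ofReal_mul hCnn,
      ← ENNReal.ofReal_add ha (by positivity), ← ENNReal.ofReal_add (by positivity) (by positivity),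
      ← ENNReal.ofReal_coe_nnreal]
    refine ENNReal.ofReal_le_ofReal ((hup y w).trans ?_)
    have h1 : ‖w‖ ^ p ≤ 2 ^ (p - 1) * (‖u y‖ ^ p + ‖w - u y‖ ^ p) := by
      refine (Real.rpow_le_rpow (norm_nonneg _) ?_ hp0.le).trans
        (by exact_mod_cast NNReal.rpow_add_le_mul_rpow_add_rpow ‖u y‖₊ ‖w - u y‖₊ hp)
      exact norm_le_norm_add_norm_sub' w (u y)
    nlinarith [mul_le_mul_of_nonneg_left h1 hc]
  have hfg : ∀ y, (f y (u y) : ℝ≥0∞) ≤ g y := fun y => by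
    simpa [ENNReal.zero_rpow_of_pos hp0] using hbound y (u y)
  have hfun : ∀ n, Measurable fun y => f y (un n y) := fun n =>
    measurable_comp_integrand hf.continuous hf.measurable (hun n)
  have hgm : AEMeasurable g μ :=
    ((hf.integrable.1.mono_measure hμν).aemeasurable.ennreal_ofReal).add
      ((hu.1.enorm.pow_const p).const_mul C)
  have hgi : ∫⁻ y, g y ∂μ ≠ ⊤ := by
    rw [lintegral_add_left' ((hf.integrable.1.mono_measure hμν).aemeasurable.ennreal_ofReal),
      lintegral_const_mul' _ _ ENNReal.ofReal_ne_top, hint]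
    refine ENNReal.add_ne_top.2 ⟨?_, ENNReal.mul_ne_top ENNReal.ofReal_ne_top
      (ENNReal.rpow_ne_top_of_nonneg hp0.le hu.2.ne)⟩
    exact ((hf.integrable.mono_measure hμν).lintegral_lt_top).ne
  have hk : Tendsto (fun n => ∫⁻ y, min (f y (un (ns n) y) : ℝ≥0∞) (g y) ∂μ) atTop
      (𝓝 (∫⁻ y, (f y (u y) : ℝ≥0∞) ∂μ)) := by
    refine tendsto_lintegral_of_dominated_convergence' g
      (fun n => (hfun _).coe_nnreal_ennreal.aemeasurable.min hgm)
      (fun n => Eventually.of_forall fun y => min_le_right _ _) hgi ?_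
    filter_upwards [hae] with y hy
    have h1 : Tendsto (fun n => (f y (un (ns n) y) : ℝ≥0∞)) atTop (𝓝 (f y (u y))) :=
      ENNReal.tendsto_coe.2 (((hf.continuous y).tendsto _).comp hy)
    have h2 := h1.min (tendsto_const_nhds (x := g y))
    rwa [min_eq_left (hfg y)] at h2
  have hr : Tendsto (fun n => C * eLpNorm (un (ns n) - u) (ENNReal.ofReal p) μ ^ p) atTop
      (𝓝 0) := by
    have h1 := ((ENNReal.continuous_rpow_const (y := p)).tendsto 0).comp
      (hlim.comp hns.tendsto_atTop)
    rw [ENNReal.zero_rpow_of_pos hp0] at h1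
    simpa using ENNReal.Tendsto.const_mul (a := C) h1 (Or.inr ENNReal.ofReal_ne_top)
  have hkr := hk.add hr
  rw [add_zero] at hkr
  obtain ⟨n, hn⟩ := (hkr.eventually_lt_const hT).exists
  refine ⟨ns n, lt_of_le_of_lt ?_ hn⟩
  rw [← hint, ← lintegral_const_mul' _ _ ENNReal.ofReal_ne_top,
    ← lintegral_add_left' ((hfun _).coe_nnreal_ennreal.aemeasurable.min hgm)]
  refine lintegral_mono fun y => ?_
  rcases le_total (f y (un (ns n) y) : ℝ≥0∞) (g y) with h | h
  · simp [min_eq_left h]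
  · simpa [min_eq_right h] using hbound y (un (ns n) y)

variable {m d : ℕ}

theorem norm_prod_le_sum (v : EuclideanSpace ℝ (Fin m)) (ξ : Fin m → Fin d → ℝ) :
    ‖(v, ξ)‖ ≤ ∑ i, |v i| + ∑ i, ∑ j, |ξ i j| := by
  have h1 : 0 ≤ ∑ i, |v i| := Finset.sum_nonneg fun _ _ => abs_nonneg _
  have h2 : 0 ≤ ∑ i, ∑ j, |ξ i j| :=
    Finset.sum_nonneg fun _ _ => Finset.sum_nonneg fun _ _ => abs_nonneg _
  refine max_le ((norm_le_sum_abs v).trans (by linarith)) (le_trans ?_ (le_add_of_nonneg_left h1))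
  rw [pi_norm_le_iff_of_nonneg h2]
  intro i
  rw [pi_norm_le_iff_of_nonneg h2]
  intro j
  refine le_trans ?_ (Finset.single_le_sum (f := fun i => ∑ j, |ξ i j|)
    (fun i _ => Finset.sum_nonneg fun j _ => abs_nonneg _) (Finset.mem_univ i))
  exact Finset.single_le_sum (f := fun j => |ξ i j|) (fun j _ => abs_nonneg _) (Finset.mem_univ j)

/-- Converts the entrywise convergence in `MemW10` into convergence of the pair (value, gradient),
the argument of the integrand. -/
theorem eLpNorm_prod_le {α : Type*} [MeasurableSpace α] {μ : Measure α} {q : ℝ≥0∞} (hq : 1 ≤ q)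
    {φ : α → EuclideanSpace ℝ (Fin m)} {G : α → Fin m → Fin d → ℝ}
    (hφ : ∀ i, AEStronglyMeasurable (fun y => φ y i) μ)
    (hG : ∀ i j, AEStronglyMeasurable (fun y => G y i j) μ) :
    eLpNorm (fun y => (φ y, G y)) q μ ≤ ∑ i, eLpNorm (fun y => φ y i) q μ +
      ∑ i, ∑ j, eLpNorm (fun y => G y i j) q μ := by
  have m1 : AEStronglyMeasurable (∑ i, fun y => |φ y i|) μ :=
    Finset.aestronglyMeasurable_sum _ fun i _ => (hφ i).norm
  have m2 : ∀ i, AEStronglyMeasurable (∑ j, fun y => |G y i j|) μ := fun i =>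
    Finset.aestronglyMeasurable_sum _ fun j _ => (hG i j).norm
  have h1 : eLpNorm (fun y => (φ y, G y)) q μ ≤
      eLpNorm ((∑ i, fun y => |φ y i|) + ∑ i, ∑ j, fun y => |G y i j|) q μ := by
    refine eLpNorm_mono_real fun y => ?_
    simpa using norm_prod_le_sum (φ y) (G y)
  refine h1.trans ((eLpNorm_add_le m1
    (Finset.aestronglyMeasurable_sum _ fun i _ => m2 i) hq).trans (add_le_add ?_ ?_))
  · refine (eLpNorm_sum_le (fun i _ => (hφ i).norm) hq).trans (le_of_eq ?_)
    exact Finset.sum_congr rfl fun i _ => eLpNorm_norm _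
  · refine (eLpNorm_sum_le (fun i _ => m2 i) hq).trans (Finset.sum_le_sum fun i _ => ?_)
    refine (eLpNorm_sum_le (fun j _ => (hG i j).norm) hq).trans (le_of_eq ?_)
    exact Finset.sum_congr rfl fun j _ => eLpNorm_norm _

theorem aestronglyMeasurable_prod {α : Type*} [MeasurableSpace α] {μ : Measure α}
    {φ : α → EuclideanSpace ℝ (Fin m)} {G : α → Fin m → Fin d → ℝ}
    (hφ : ∀ i, AEStronglyMeasurable (fun y => φ y i) μ)
    (hG : ∀ i j, AEStronglyMeasurable (fun y => G y i j) μ) :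
    AEStronglyMeasurable (fun y => (φ y, G y)) μ := by
  refine AEStronglyMeasurable.prodMk ?_ ?_
  · have h : AEMeasurable (fun y i => φ y i) μ :=
      aemeasurable_pi_lambda _ fun i => (hφ i).aemeasurable
    exact (PiLp.continuous_toLp 2 (fun _ : Fin m => ℝ)).comp_aestronglyMeasurable
      h.aestronglyMeasurable
  · exact (aemeasurable_pi_lambda _ fun i => aemeasurable_pi_lambda _ fun j =>
      (hG i j).aemeasurable).aestronglyMeasurable

/-- Competitors in `W^{1,p}_0` can be replaced by test maps. -/
theorem IsRegularIntegrand.exists_testFunction_lintegral_lt {p : ℝ} (hp : 1 ≤ p)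
    {a : EuclideanSpace ℝ (Fin d) → ℝ}
    {f : EuclideanSpace ℝ (Fin d) → EuclideanSpace ℝ (Fin m) × (Fin m → Fin d → ℝ) → ℝ≥0}
    (hf : IsRegularIntegrand volume p a f) {U : Set (EuclideanSpace ℝ (Fin d))}
    {b : EuclideanSpace ℝ (Fin d) → EuclideanSpace ℝ (Fin m) × (Fin m → Fin d → ℝ)}
    (hb : Measurable b) (hbp : MemLp b (ENNReal.ofReal p) (volume.restrict U))
    {φ : EuclideanSpace ℝ (Fin d) → EuclideanSpace ℝ (Fin m)}
    {G : EuclideanSpace ℝ (Fin d) → Fin m → Fin d → ℝ}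
    (h : MemW10 (ENNReal.ofReal p) U φ G) {T : ℝ≥0∞}
    (hT : ∫⁻ y in U, (f y (b y + (φ y, G y)) : ℝ≥0∞) < T) :
    ∃ ψ, IsTestFunction U ψ ∧ ∫⁻ y in U, (f y (b y + (ψ y, gradMat ψ y)) : ℝ≥0∞) < T := by
  have hq : 1 ≤ ENNReal.ofReal p := ENNReal.one_le_ofReal.2 hp
  obtain ⟨ψ, hψ, h1, h2⟩ := h.approx
  have hu : MemLp (fun y => ((φ y, G y) : EuclideanSpace ℝ (Fin m) × (Fin m → Fin d → ℝ)))
      (ENNReal.ofReal p) (volume.restrict U) := by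
    refine ⟨aestronglyMeasurable_prod (fun i => (h.memW1.memLp i).1)
      fun i j => (h.memW1.memLp_grad i j).1, ?_⟩
    refine (eLpNorm_prod_le hq (fun i => (h.memW1.memLp i).1)
      fun i j => (h.memW1.memLp_grad i j).1).trans_lt ?_
    refine ENNReal.add_lt_top.2 ⟨ENNReal.sum_lt_top.2 fun i _ => (h.memW1.memLp i).2,
      ENNReal.sum_lt_top.2 fun i _ => ENNReal.sum_lt_top.2 fun j _ =>
        (h.memW1.memLp_grad i j).2⟩
  have hψm : ∀ n, Measurable fun y => (ψ n y, gradMat (ψ n) y) := fun n =>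
    ((hψ n).smooth.continuous.prodMk (hψ n).continuous_gradMat).measurable
  have hlim : Tendsto (fun n => eLpNorm ((fun y => b y + (ψ n y, gradMat (ψ n) y)) -
      fun y => b y + (φ y, G y)) (ENNReal.ofReal p) (volume.restrict U)) atTop (𝓝 0) := by
    have hsum := (tendsto_finsetSum Finset.univ fun i _ => h1 i).add
      (tendsto_finsetSum Finset.univ fun i _ => tendsto_finsetSum Finset.univ fun j _ => h2 i j)
    simp only [Finset.sum_const_zero, add_zero] at hsum
    refine tendsto_of_tendsto_of_tendsto_of_le_of_le tendsto_const_nhds hsum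
      (fun _ => zero_le) fun n => ?_
    refine le_trans (le_of_eq ?_) (eLpNorm_prod_le hq (φ := fun y => ψ n y - φ y)
      (G := fun y => gradMat (ψ n) y - G y) (fun i => ?_) fun i j => ?_)
    · congr 1
      ext1 y
      simp
    · exact (((hψ n).memW1 1).memLp i).1.sub (h.memW1.memLp i).1
    · exact (((hψ n).memW1 1).memLp_grad i j).1.sub (h.memW1.memLp_grad i j).1
  obtain ⟨n, hn⟩ := hf.exists_lintegral_lt (Measure.restrict_le_self (s := U)) hp
    (un := fun n y => b y + (ψ n y, gradMat (ψ n) y)) (fun n => hb.add (hψm n)) (hbp.add hu)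
    hlim hT
  exact ⟨ψ n, hψ n, hn⟩

end Approximation

/-! ### Lipschitz truncation of vector-valued test maps. -/

section Truncation

variable {m d : ℕ}

theorem norm_fderiv_le_mul_norm_gradMat
    (ψ : EuclideanSpace ℝ (Fin d) → EuclideanSpace ℝ (Fin m)) (i : Fin m)
    (y : EuclideanSpace ℝ (Fin d)) :
    ‖fderiv ℝ (fun z => ψ z i) y‖ ≤ d * ‖gradMat ψ y‖ := by
  refine ContinuousLinearMap.opNorm_le_bound _ (by positivity) fun z => ?_
  have hz : z = ∑ j, z j • EuclideanSpace.single j (1 : ℝ) := by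
    ext k
    simp [Finset.sum_apply, Pi.single_apply]
  conv_lhs => rw [hz]
  rw [map_sum]
  refine (norm_sum_le _ _).trans ?_
  have h : ∀ j ∈ Finset.univ, ‖fderiv ℝ (fun z => ψ z i) y (z j • EuclideanSpace.single j (1 : ℝ))‖ ≤
      ‖gradMat ψ y‖ * ‖z‖ := by
    intro j _
    rw [map_smul, norm_smul, mul_comm]
    refine mul_le_mul ?_ (PiLp.norm_apply_le z j) (norm_nonneg _) (norm_nonneg _)
    exact (norm_le_pi_norm (gradMat ψ y i) j).trans (norm_le_pi_norm (gradMat ψ y) i)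
  refine (Finset.sum_le_card_nsmul _ _ _ h).trans (le_of_eq ?_)
  simp [mul_assoc]

/-- Lipschitz truncation of a test map at one of finitely many levels, with a quantitative
bound on the set where the map is modified. -/
theorem exists_truncation (hd : 1 ≤ d) {p : ℝ} (hp : 1 < p) :
    ∃ C : ℝ≥0, ∀ ψ : EuclideanSpace ℝ (Fin d) → EuclideanSpace ℝ (Fin m),
      IsTestFunction (unitCube d) ψ → ∀ N : ℕ, 0 < N →
      ∃ k < N, ∃ w : EuclideanSpace ℝ (Fin d) → EuclideanSpace ℝ (Fin m),
        (∀ i, LipschitzWith (2 * 4 ^ d * 2 ^ k) fun y => w y i) ∧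
        (∀ y ∉ unitCube d, w y = 0) ∧
        (∀ᵐ y, w y = ψ y → gradMat w y = gradMat ψ y) ∧
        (N : ℝ≥0∞) * ((((2 : ℝ≥0) ^ k) ^ p : ℝ≥0) * volume {y | w y ≠ ψ y}) ≤
          C * ∫⁻ y in unitCube d, ‖gradMat ψ y‖ₑ ^ p := by
  have hp0 : 0 < p := one_pos.trans hp
  obtain ⟨C, hC⟩ := exists_level_maximalSet hd hp
  refine ⟨C * (d : ℝ≥0) ^ p, fun ψ hψ N hN => ?_⟩
  -- One function dominates the gradients of all components, so a single level and a single bad set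
  -- serve them all.
  let g : EuclideanSpace ℝ (Fin d) → ℝ≥0 := fun y => d * ‖gradMat ψ y‖₊
  have hg : Measurable g := (measurable_gradMat ψ).nnnorm.const_mul _
  have hfg : ∀ i y, ‖fderiv ℝ (fun z => ψ z i) y‖ ≤ g y := fun i y => by
    simpa [g] using norm_fderiv_le_mul_norm_gradMat ψ i y
  obtain ⟨k, hk, hkN⟩ := hC g hg N hN
  choose w hwL hw0 hw using fun i => exists_lipschitz_truncation
    ((hψ.component i).smooth.of_le (by simp)) hg (hfg i)
    (fun y hy => (hψ.component i).eq_zero hy) (2 ^ k)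
  refine ⟨k, hk, fun y => WithLp.toLp 2 fun i => w i y, hwL, fun y hy => ?_, ?_, ?_⟩
  · ext i; exact hw0 i y hy
  · have h := fun i => ae_fderiv_eq_of_eq (hwL i).continuous (hψ.component i).smooth.continuous
      (hwL i).ae_differentiableAt
      (Eventually.of_forall fun y => (hψ.component i).differentiable y)
    filter_upwards [ae_all_iff.2 h] with y hy hyw
    ext i j
    have h1 : w i y = ψ y i := by rw [← hyw]
    have h2 := hy i h1
    change fderiv ℝ (w i) y _ = fderiv ℝ (fun z => ψ z i) y _
    rw [h2]
  · have hsub : {y | WithLp.toLp 2 (fun i => w i y) ≠ ψ y} ⊆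
        maximalSet (fun y => g y) ((2 : ℝ≥0) ^ k : ℝ≥0) := by
      intro y hy
      by_contra hyb
      exact hy (by ext i; exact hw i y hyb)
    have h1 : ∫⁻ y, ((g y ^ p : ℝ≥0) : ℝ≥0∞) =
        (((d : ℝ≥0) ^ p : ℝ≥0) : ℝ≥0∞) * ∫⁻ y in unitCube d, ‖gradMat ψ y‖ₑ ^ p := by
      rw [← lintegral_const_mul' _ _ ENNReal.coe_ne_top,
        ← lintegral_indicator (show MeasurableSet (unitCube d) from measurableSet_cube 0 1)]
      congr 1
      ext y
      by_cases hy : y ∈ unitCube d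
      · rw [Set.indicator_of_mem hy, NNReal.mul_rpow, ENNReal.coe_mul,
          ENNReal.coe_rpow_of_nonneg ‖gradMat ψ y‖₊ hp0.le]
        rfl
      · rw [Set.indicator_of_notMem hy]
        simp [g, hψ.gradMat_eq_zero hy, NNReal.zero_rpow hp0.ne']
    calc _ ≤ (N : ℝ≥0∞) * ((((2 : ℝ≥0) ^ k) ^ p : ℝ≥0) *
          volume (maximalSet (fun y => g y) ((2 : ℝ≥0) ^ k : ℝ≥0))) := by gcongr
      _ ≤ _ := hkN
      _ = _ := by rw [h1, ENNReal.coe_mul, mul_assoc]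

/-- A unit vector along an axis lies outside the cube, so `w` vanishes there and the Lipschitz bound
carries over to the whole cube. -/
theorem norm_le_of_lipschitzWith_of_eq_zero (hd : 1 ≤ d)
    {w : EuclideanSpace ℝ (Fin d) → EuclideanSpace ℝ (Fin m)} {K : ℝ≥0}
    (hw : ∀ i, LipschitzWith K fun y => w y i) (hw0 : ∀ y ∉ unitCube d, w y = 0)
    {z : EuclideanSpace ℝ (Fin d)} (hz : z ∈ unitCube d) : ‖w z‖ ≤ m * (K * (d + 1)) := by
  let e : EuclideanSpace ℝ (Fin d) := EuclideanSpace.single ⟨0, hd⟩ 1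
  have he : e ∉ unitCube d := by
    intro h
    have := h ⟨0, hd⟩
    simp [e] at this
    norm_num at this
  have h1 : ‖z - e‖ ≤ d + 1 := by
    have h2 := norm_le_of_mem_cube hz
    have h3 : ‖e‖ = 1 := by simp [e]
    have h4 := norm_sub_le z e
    rw [sub_zero] at h2
    have h5 : (0 : ℝ) ≤ d := d.cast_nonneg
    linarith
  have h2 : ∀ i ∈ Finset.univ, |w z i| ≤ K * (d + 1) := fun i _ => by
    have h3 := (hw i).dist_le_mul z e
    simp only [hw0 e he, PiLp.zero_apply, dist_zero_right, Real.norm_eq_abs] at h3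
    rw [dist_eq_norm] at h3
    exact h3.trans (by gcongr)
  exact (norm_le_sum_abs _).trans ((Finset.sum_le_card_nsmul _ _ _ h2).trans (by simp))

end Truncation

/-! ### Blow-up at a Lebesgue point: the upper bound. -/

section BlowUp

variable {m d : ℕ}

/-- The arguments of the integrand, after rescaling of a cube of side `ρ` to the unit cube. -/
noncomputable def blowUp (v : EuclideanSpace ℝ (Fin m)) (ξ : Fin m → Fin d → ℝ)
    (w : EuclideanSpace ℝ (Fin d) → EuclideanSpace ℝ (Fin m)) (ρ : ℝ)
    (z : EuclideanSpace ℝ (Fin d)) : EuclideanSpace ℝ (Fin m) × (Fin m → Fin d → ℝ) :=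
  (v + ρ • (matApply ξ z + w z), ξ + gradMat w z)

/-- `x` is a Lebesgue point of `y ↦ f y`, uniformly on bounded sets. -/
def IsUniformLebesguePoint {W : Type*} [NormedAddCommGroup W]
    (f : EuclideanSpace ℝ (Fin d) → W → ℝ≥0) (x : EuclideanSpace ℝ (Fin d)) : Prop :=
  ∀ R : ℝ, ∃ h : EuclideanSpace ℝ (Fin d) → ℝ≥0∞, Measurable h ∧
    (∀ y w, ‖w‖ ≤ R → (f y w : ℝ≥0∞) ≤ f x w + h y ∧ (f x w : ℝ≥0∞) ≤ f y w + h y) ∧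
    Tendsto (fun ρ : ℝ => ∫⁻ z in unitCube d, h (x + ρ • z)) (𝓝[>] 0) (𝓝 0)

theorem IsRegularIntegrand.ae_isUniformLebesguePoint {W : Type*} [NormedAddCommGroup W]
    [ProperSpace W] {p : ℝ} (hp : 0 ≤ p) {a : EuclideanSpace ℝ (Fin d) → ℝ}
    {f : EuclideanSpace ℝ (Fin d) → W → ℝ≥0} (hf : IsRegularIntegrand volume p a f) :
    ∀ᵐ x, IsUniformLebesguePoint f x := by
  filter_upwards [ae_all_iff.2 fun n : ℕ => hf.exists_modulus hp n] with x hx R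
  obtain ⟨n, hn⟩ := exists_nat_ge R
  obtain ⟨h, h1, h2, h3⟩ := hx n
  exact ⟨h, h1, fun y w hw => h2 y w (hw.trans hn), h3⟩

theorem continuous_matApply (ξ : Matrix (Fin m) (Fin d) ℝ) : Continuous (matApply ξ) := by
  have h : matApply ξ = (Matrix.toEuclideanLin ξ : EuclideanSpace ℝ (Fin d) → _) := rfl
  rw [h]
  exact LinearMap.continuous_of_finiteDimensional _

theorem isBounded_unitCube : Bornology.IsBounded (unitCube d) :=
  Metric.isBounded_closedBall.subset (cube_subset_closedBall 0 one_pos)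

theorem exists_norm_matApply_le (ξ : Matrix (Fin m) (Fin d) ℝ) :
    ∃ B : ℝ, ∀ z ∈ unitCube d, ‖matApply ξ z‖ ≤ B := by
  obtain ⟨B, hB⟩ := isBounded_unitCube.isCompact_closure.exists_bound_of_continuousOn
    (continuous_matApply ξ).continuousOn
  exact ⟨B, fun z hz => hB z (subset_closure hz)⟩

theorem norm_blowUp_le {v : EuclideanSpace ℝ (Fin m)} {ξ : Fin m → Fin d → ℝ}
    {w : EuclideanSpace ℝ (Fin d) → EuclideanSpace ℝ (Fin m)} {ρ B S Λ : ℝ} (hρ : 0 ≤ ρ)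
    (hρ1 : ρ ≤ 1) {z : EuclideanSpace ℝ (Fin d)} (hB : ‖matApply ξ z‖ ≤ B) (hS : ‖w z‖ ≤ S)
    (hΛ : ‖gradMat w z‖ ≤ Λ) : ‖blowUp v ξ w ρ z‖ ≤ ‖v‖ + ‖ξ‖ + B + S + Λ := by
  have h1 : ‖ρ • (matApply ξ z + w z)‖ ≤ B + S := by
    rw [norm_smul, Real.norm_of_nonneg hρ]
    refine (mul_le_of_le_one_left (norm_nonneg _) hρ1).trans ((norm_add_le _ _).trans ?_)
    linarith
  have h2 := norm_add_le v (ρ • (matApply ξ z + w z))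
  have h3 := norm_add_le ξ (gradMat w z)
  have := norm_nonneg v
  have := norm_nonneg ξ
  have := norm_nonneg (matApply ξ z)
  have := norm_nonneg (w z)
  have := norm_nonneg (gradMat w z)
  exact max_le (by simp only [blowUp]; linarith) (by simp only [blowUp]; linarith)

/-- Fixed test maps: the rescaled energies converge from above. -/
theorem limsup_lintegral_blowUp_le
    {f : EuclideanSpace ℝ (Fin d) → EuclideanSpace ℝ (Fin m) × (Fin m → Fin d → ℝ) → ℝ≥0}
    {x : EuclideanSpace ℝ (Fin d)} (hfc : Continuous (f x)) (hx : IsUniformLebesguePoint f x)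
    (v : EuclideanSpace ℝ (Fin m)) (ξ : Fin m → Fin d → ℝ)
    {ψ : EuclideanSpace ℝ (Fin d) → EuclideanSpace ℝ (Fin m)}
    (hψ : IsTestFunction (unitCube d) ψ) :
    limsup (fun ρ : ℝ => ∫⁻ z in unitCube d, (f (x + ρ • z) (blowUp v ξ ψ ρ z) : ℝ≥0∞)) (𝓝[>] 0) ≤
      ∫⁻ z in unitCube d, (f x (v, ξ + gradMat ψ z) : ℝ≥0∞) := by
  have hm : MeasurableSet (unitCube d) := measurableSet_cube 0 1
  obtain ⟨B, hB⟩ := exists_norm_matApply_le ξ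
  obtain ⟨S, hS⟩ := hψ.smooth.continuous.bounded_above_of_compact_support hψ.compact
  obtain ⟨Λ, hΛ⟩ := hψ.continuous_gradMat.bounded_above_of_compact_support
    (HasCompactSupport.of_support_subset_isCompact hψ.compact fun y hy => by
      by_contra h
      refine hy ?_
      ext i j
      refine partialDeriv_eq_zero_of_notMem (fun hi => h ?_) j
      refine closure_mono (fun z hz => ?_) hi
      contrapose! hz
      have : ψ z = 0 := by simpa using hz
      simp [this])
  set R := ‖v‖ + ‖ξ‖ + B + S + Λ
  obtain ⟨h, hh, hfh, hlim⟩ := hx R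
  obtain ⟨C, hC⟩ : ∃ C : ℝ≥0, ∀ w, ‖w‖ ≤ R → f x w ≤ C := by
    obtain ⟨C, hC⟩ := (isCompact_closedBall
      (0 : EuclideanSpace ℝ (Fin m) × (Fin m → Fin d → ℝ)) R).bddAbove_image hfc.continuousOn
    exact ⟨C, fun w hw => hC (Set.mem_image_of_mem _ (by simpa using hw))⟩
  have hbc : ∀ ρ, Continuous (blowUp v ξ ψ ρ) := fun ρ => by
    have h1 := continuous_matApply ξ
    have h2 := hψ.smooth.continuous
    have h3 := hψ.continuous_gradMat
    unfold blowUp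
    fun_prop
  have hsmall : ∀ᶠ ρ : ℝ in 𝓝[>] 0, 0 ≤ ρ ∧ ρ ≤ 1 := by
    filter_upwards [Ioc_mem_nhdsGT (zero_lt_one (α := ℝ))] with ρ hρ using ⟨hρ.1.le, hρ.2⟩
  -- With the base point frozen at `x`, only the value argument still moves, and it converges to
  -- `v`. The cost of freezing is the integral of `h`, added below.
  have h1 : Tendsto (fun ρ : ℝ => ∫⁻ z in unitCube d, (f x (blowUp v ξ ψ ρ z) : ℝ≥0∞)) (𝓝[>] 0)
      (𝓝 (∫⁻ z in unitCube d, (f x (v, ξ + gradMat ψ z) : ℝ≥0∞))) := by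
    refine tendsto_lintegral_filter_of_dominated_convergence (fun _ => (C : ℝ≥0∞))
      (Eventually.of_forall fun ρ => (hfc.comp (hbc ρ)).measurable.coe_nnreal_ennreal) ?_ ?_ ?_
    · filter_upwards [hsmall] with ρ hρ
      filter_upwards [ae_restrict_mem hm] with z hz
      exact ENNReal.coe_le_coe.2 (hC _ (norm_blowUp_le hρ.1 hρ.2 (hB z hz) (hS z) (hΛ z)))
    · simp [volume_unitCube]
    · refine Eventually.of_forall fun z => ?_
      refine ENNReal.tendsto_coe.2 ((hfc.tendsto _).comp ?_)
      refine tendsto_nhdsWithin_of_tendsto_nhds ?_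
      have hc : Continuous fun ρ : ℝ => blowUp v ξ ψ ρ z := by
        unfold blowUp; fun_prop
      simpa [blowUp] using hc.tendsto 0
  have h2 := h1.add hlim
  rw [add_zero] at h2
  rw [← h2.limsup_eq]
  refine limsup_le_limsup ?_
  filter_upwards [hsmall] with ρ hρ
  have hmeas : Measurable fun z => (f x (blowUp v ξ ψ ρ z) : ℝ≥0∞) :=
    (hfc.comp (hbc ρ)).measurable.coe_nnreal_ennreal
  rw [← lintegral_add_left hmeas]
  refine setLIntegral_mono' hm fun z hz => ?_
  exact (hfh _ _ (norm_blowUp_le hρ.1 hρ.2 (hB z hz) (hS z) (hΛ z))).1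

end BlowUp

/-! ### Lower bound by truncation of near-minimisers. -/

section LowerBound

variable {m d : ℕ}

theorem lintegral_rpow_gradMat_le {p : ℝ} (hp : 1 ≤ p) {α : ℝ} (hα : 0 < α)
    {F : EuclideanSpace ℝ (Fin d) → ℝ≥0} {ξ : Fin m → Fin d → ℝ}
    {ψ : EuclideanSpace ℝ (Fin d) → EuclideanSpace ℝ (Fin m)}
    (hF : ∀ᵐ z ∂(volume.restrict (unitCube d)), α * ‖ξ + gradMat ψ z‖ ^ p ≤ F z) :
    ∫⁻ z in unitCube d, ‖gradMat ψ z‖ₑ ^ p ≤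
      2 ^ (p - 1) * ((∫⁻ z in unitCube d, (F z : ℝ≥0∞)) / ENNReal.ofReal α + ‖ξ‖ₑ ^ p) := by
  have hp0 : 0 < p := one_pos.trans_le hp
  have hα' : ENNReal.ofReal α ≠ 0 := by simpa using hα
  have h1 : ∫⁻ z in unitCube d, ‖ξ + gradMat ψ z‖ₑ ^ p ≤
      (∫⁻ z in unitCube d, (F z : ℝ≥0∞)) / ENNReal.ofReal α := by
    rw [ENNReal.le_div_iff_mul_le (Or.inl hα') (Or.inl ENNReal.ofReal_ne_top), mul_comm,
      ← lintegral_const_mul' _ _ ENNReal.ofReal_ne_top]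
    refine lintegral_mono_ae ?_
    filter_upwards [hF] with z hz
    rw [← ofReal_norm, ENNReal.ofReal_rpow_of_nonneg (norm_nonneg _) hp0.le,
      ← ENNReal.ofReal_mul hα.le, ← ENNReal.ofReal_coe_nnreal]
    exact ENNReal.ofReal_le_ofReal hz
  have h2 : (2 : ℝ≥0∞) ^ (p - 1) ≠ ⊤ :=
    ENNReal.rpow_ne_top_of_nonneg (by linarith) (by simp)
  calc ∫⁻ z in unitCube d, ‖gradMat ψ z‖ₑ ^ p
      ≤ ∫⁻ z in unitCube d, 2 ^ (p - 1) * (‖ξ + gradMat ψ z‖ₑ ^ p + ‖ξ‖ₑ ^ p) := by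
        refine lintegral_mono fun z => ?_
        refine le_trans ?_ (ENNReal.rpow_add_le_mul_rpow_add_rpow _ _ hp)
        refine ENNReal.rpow_le_rpow ?_ hp0.le
        have : gradMat ψ z = (ξ + gradMat ψ z) - ξ := by abel
        conv_lhs => rw [this]
        exact enorm_sub_le
    _ = 2 ^ (p - 1) * ((∫⁻ z in unitCube d, ‖ξ + gradMat ψ z‖ₑ ^ p) + ‖ξ‖ₑ ^ p) := by
        rw [lintegral_const_mul' _ _ h2, lintegral_add_right _ measurable_const,
          setLIntegral_const, volume_unitCube, mul_one]
    _ ≤ _ := by gcongr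

/-- The growth bound on Lipschitz maps, homogeneous in the Lipschitz constant. -/
theorem exists_bound_of_growth {p : ℝ} (hp : 1 ≤ p)
    {F : EuclideanSpace ℝ (Fin m) × (Fin m → Fin d → ℝ) → ℝ≥0} {a c : ℝ} (ha : 0 ≤ a) (hc : 0 ≤ c)
    (hF : ∀ w, (F w : ℝ) ≤ a + c * ‖w‖ ^ p) (v : EuclideanSpace ℝ (Fin m))
    (ξ : Fin m → Fin d → ℝ) {κ : ℝ} (hκ : 0 ≤ κ) :
    ∃ c' : ℝ≥0, ∀ ζ : Fin m → Fin d → ℝ, ∀ t : ℝ≥0, 1 ≤ t → ‖ζ‖ ≤ κ * t →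
      F (v, ξ + ζ) ≤ c' * t ^ p := by
  have hp0 : 0 < p := one_pos.trans_le hp
  refine ⟨(a + c * (2 ^ (p - 1) * (‖(v, ξ)‖ ^ p + κ ^ p))).toNNReal, fun ζ t ht hζ => ?_⟩
  rw [← NNReal.coe_le_coe]
  push_cast
  rw [Real.coe_toNNReal _ (by positivity)]
  refine (hF _).trans ?_
  have h1 : ‖(v, ξ + ζ)‖ ≤ ‖(v, ξ)‖ + κ * t := by
    have : (v, ξ + ζ) = (v, ξ) + (0, ζ) := by simp
    rw [this]
    refine (norm_add_le _ _).trans ?_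
    have : ‖((0 : EuclideanSpace ℝ (Fin m)), ζ)‖ = ‖ζ‖ := by simp [Prod.norm_def]
    linarith
  have h2 : ‖(v, ξ + ζ)‖ ^ p ≤ 2 ^ (p - 1) * (‖(v, ξ)‖ ^ p + (κ * t) ^ p) := by
    refine (Real.rpow_le_rpow (norm_nonneg _) h1 hp0.le).trans ?_
    exact_mod_cast NNReal.rpow_add_le_mul_rpow_add_rpow ‖(v, ξ)‖₊ (⟨κ, hκ⟩ * t) hp
  rw [Real.mul_rpow hκ t.coe_nonneg] at h2
  have h3 : (1 : ℝ) ≤ (t : ℝ) ^ p := Real.one_le_rpow (by exact_mod_cast ht) hp0.le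
  have h4 : 0 ≤ ‖(v, ξ)‖ ^ p := by positivity
  have h5 : (0 : ℝ) ≤ 2 ^ (p - 1) := by positivity
  calc a + c * ‖(v, ξ + ζ)‖ ^ p
      ≤ a * (t : ℝ) ^ p + c * (2 ^ (p - 1) * (‖(v, ξ)‖ ^ p * (t : ℝ) ^ p + κ ^ p * (t : ℝ) ^ p)) := by
        refine add_le_add (le_mul_of_one_le_right ha h3) (mul_le_mul_of_nonneg_left ?_ hc)
        refine h2.trans (mul_le_mul_of_nonneg_left ?_ h5)
        gcongr
        exact le_mul_of_one_le_right h4 h3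
    _ = _ := by ring

/-- Rescaled energies bounded along vanishing scales bound the relaxed frozen energy. -/
theorem iInf_testFunction_le_of_eventually (hd : 1 ≤ d) {p : ℝ} (hp : 1 < p)
    {f : EuclideanSpace ℝ (Fin d) → EuclideanSpace ℝ (Fin m) × (Fin m → Fin d → ℝ) → ℝ≥0}
    {x : EuclideanSpace ℝ (Fin d)} (hfc : Continuous (f x)) {a c : ℝ} (ha : 0 ≤ a) (hc : 0 ≤ c)
    (hup : ∀ w, (f x w : ℝ) ≤ a + c * ‖w‖ ^ p) (hx : IsUniformLebesguePoint f x)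
    {α : ℝ} (hα : 0 < α)
    (hcoer : ∀ᶠ ρ : ℝ in 𝓝[>] 0, ∀ᵐ z ∂(volume.restrict (unitCube d)), ∀ w,
      α * ‖w.2‖ ^ p ≤ f (x + ρ • z) w)
    (v : EuclideanSpace ℝ (Fin m)) (ξ : Fin m → Fin d → ℝ) {T : ℝ≥0∞} (hT : T ≠ ⊤)
    (hev : ∀ᶠ ρ : ℝ in 𝓝[>] 0, ∃ ψ : EuclideanSpace ℝ (Fin d) → EuclideanSpace ℝ (Fin m),
      IsTestFunction (unitCube d) ψ ∧
        ∫⁻ z in unitCube d, (f (x + ρ • z) (blowUp v ξ ψ ρ z) : ℝ≥0∞) < T) :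
    ⨅ (ψ : EuclideanSpace ℝ (Fin d) → EuclideanSpace ℝ (Fin m))
      (_ : IsTestFunction (unitCube d) ψ),
      ∫⁻ z in unitCube d, (f x (v, ξ + gradMat ψ z) : ℝ≥0∞) ≤ T := by
  have hm : MeasurableSet (unitCube d) := measurableSet_cube 0 1
  have hp0 : 0 < p := one_pos.trans hp
  obtain ⟨C, hC⟩ := exists_truncation (m := m) hd hp
  obtain ⟨c', hc'⟩ := exists_bound_of_growth hp.le ha hc hup v ξ (κ := 2 * 4 ^ d) (by positivity)
  obtain ⟨B, hB⟩ := exists_norm_matApply_le (m := m) (d := d) ξ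
  -- By coercivity, this bounds the `p`-th power gradient integral of every near-minimiser,
  -- independently of `ρ`.
  let M : ℝ≥0∞ := 2 ^ (p - 1) * (T / ENNReal.ofReal α + ‖ξ‖ₑ ^ p)
  have hM : M ≠ ⊤ := by
    refine ENNReal.mul_ne_top (ENNReal.rpow_ne_top_of_nonneg (by linarith) (by simp))
      (ENNReal.add_ne_top.2 ⟨ENNReal.div_ne_top hT (by simpa using hα),
        ENNReal.rpow_ne_top_of_nonneg hp0.le enorm_ne_top⟩)
  refine ENNReal.le_of_forall_pos_le_add fun ε hε _ => ?_
  have hε3 : 0 < ε / 3 := by positivity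
  have hε3' : ((ε / 3 : ℝ≥0) : ℝ≥0∞) ≠ 0 := by simpa using hε3.ne'
  -- Enough levels to bring the energy on the modified set, at most `c' * C * M / N`, below `ε / 3`.
  obtain ⟨N, hN⟩ := ENNReal.exists_nat_mul_gt hε3'
    (show (c' : ℝ≥0∞) * (C * M) ≠ ⊤ by finiteness)
  have hN0 : 0 < N := by
    rcases Nat.eq_zero_or_pos N with rfl | h
    · simp at hN
    · exact h
  -- `Λ`, `S` and `R` bound the gradient, the values and the full argument of the truncated map
  -- whatever `k < N` turns out to be. They precede `ρ`, so `h` and `δ` can be fixed now.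
  let Λ : ℝ≥0 := 2 * 4 ^ d * 2 ^ N
  let S : ℝ := m * (Λ * (d + 1))
  let R : ℝ := ‖v‖ + ‖ξ‖ + B + S + Λ
  obtain ⟨h, hhm, hfh, hlim⟩ := hx R
  obtain ⟨δ, hδ, hfδ⟩ := Metric.uniformContinuousOn_iff.1
    ((isCompact_closedBall (0 : EuclideanSpace ℝ (Fin m) × (Fin m → Fin d → ℝ))
      R).uniformContinuousOn_of_continuous hfc.continuousOn) (ε / 3 : ℝ≥0) hε3
  have hsmall : ∀ᶠ ρ : ℝ in 𝓝[>] 0, (0 ≤ ρ ∧ ρ ≤ 1) ∧ ρ * (B + S) < δ := by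
    refine (Eventually.and ?_ ?_)
    · filter_upwards [Ioc_mem_nhdsGT (zero_lt_one (α := ℝ))] with ρ hρ using ⟨hρ.1.le, hρ.2⟩
    · refine nhdsWithin_le_nhds (ContinuousAt.eventually_lt (by fun_prop) (by fun_prop) ?_)
      simpa using hδ
  obtain ⟨ρ, ⟨⟨hρ0, hρ1⟩, hρδ⟩, hρh, hρc, ψ, hψ, hψT⟩ := (hsmall.and
    ((hlim.eventually_lt_const (pos_iff_ne_zero.2 hε3')).and (hcoer.and hev))).exists
  obtain ⟨k, hk, w, hwL, hw0, hwψ, hwN⟩ := hC ψ hψ N hN0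
  have hKΛ : 2 * 4 ^ d * 2 ^ k ≤ Λ := by
    simp only [Λ]
    gcongr
    exact one_le_two
  have hgw : ∀ z, ‖gradMat w z‖ ≤ 2 * 4 ^ d * ((2 ^ k : ℝ≥0) : ℝ) := fun z => by
    simpa using norm_gradMat_le_of_lipschitzWith hwL z
  have hgΛ : ∀ z, ‖gradMat w z‖ ≤ Λ := fun z =>
    (norm_gradMat_le_of_lipschitzWith hwL z).trans (by exact_mod_cast hKΛ)
  have hwS : ∀ z ∈ unitCube d, ‖w z‖ ≤ S := fun z hz => by
    refine (norm_le_of_lipschitzWith_of_eq_zero hd hwL hw0 hz).trans ?_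
    have : ((2 * 4 ^ d * 2 ^ k : ℝ≥0) : ℝ) ≤ Λ := by exact_mod_cast hKΛ
    simp only [S]
    gcongr
  have hwc : Continuous w :=
    (PiLp.continuous_toLp 2 (fun _ : Fin m => ℝ)).comp (continuous_pi fun i => (hwL i).continuous)
  let A : Set (EuclideanSpace ℝ (Fin d)) := {y | w y ≠ ψ y}
  have hA : MeasurableSet A := (isOpen_ne_fun hwc hψ.smooth.continuous).measurableSet
  let e : ℝ≥0∞ := ((c' * (2 ^ k) ^ p : ℝ≥0) : ℝ≥0∞)
  have hbad : e * volume A ≤ (ε / 3 : ℝ≥0) := by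
    have hN0' : (N : ℝ≥0∞) ≠ 0 := by exact_mod_cast hN0.ne'
    rw [← ENNReal.mul_le_mul_iff_right hN0' (ENNReal.natCast_ne_top N)]
    refine le_trans ?_ hN.le
    have h1 := lintegral_rpow_gradMat_le hp.le hα (ξ := ξ) (ψ := ψ)
      (F := fun z => f (x + ρ • z) (blowUp v ξ ψ ρ z)) (by
        filter_upwards [hρc] with z hz using hz (blowUp v ξ ψ ρ z))
    calc (N : ℝ≥0∞) * (e * volume A)
        = c' * (N * ((((2 : ℝ≥0) ^ k) ^ p : ℝ≥0) * volume A)) := by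
          simp only [e]; rw [ENNReal.coe_mul]; ring
      _ ≤ c' * (C * ∫⁻ y in unitCube d, ‖gradMat ψ y‖ₑ ^ p) := by gcongr
      _ ≤ c' * (C * M) := by
          gcongr
          refine h1.trans ?_
          simp only [M]
          gcongr
  -- comparison with the frozen energy of the truncated map
  have hD : ⨅ (ψ : EuclideanSpace ℝ (Fin d) → EuclideanSpace ℝ (Fin m))
      (_ : IsTestFunction (unitCube d) ψ),
      ∫⁻ z in unitCube d, (f x (v, ξ + gradMat ψ z) : ℝ≥0∞) ≤
      ∫⁻ z in unitCube d, (f x (v, ξ + gradMat w z) : ℝ≥0∞) := by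
    by_contra! hlt
    obtain ⟨χ, hχ, hχ'⟩ := exists_testFunction_of_lipschitzWith hwL hw0
      (g := fun ζ => f x (v, ξ + ζ)) (by fun_prop) hlt
    exact absurd hχ' (not_lt.2 (iInf₂_le χ hχ))
  -- Where `w = ψ` the gradients agree almost everywhere, and the cost is `h` for moving the base
  -- point and `ε / 3` for moving the value. On `A` the energy of `ψ` is dropped, and growth bounds
  -- that of `w` by `e`.
  have hpt : ∀ᵐ z ∂(volume.restrict (unitCube d)), (f x (v, ξ + gradMat w z) : ℝ≥0∞) ≤
      f (x + ρ • z) (blowUp v ξ ψ ρ z) +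
        (h (x + ρ • z) + ((ε / 3 : ℝ≥0) + A.indicator (fun _ => e) z)) := by
    filter_upwards [ae_restrict_of_ae hwψ, ae_restrict_mem hm] with z hz hzY
    by_cases hzA : w z = ψ z
    · have e1 : blowUp v ξ ψ ρ z = blowUp v ξ w ρ z := by simp [blowUp, hz hzA, hzA]
      have e2 : (v, ξ + gradMat w z) = blowUp v ξ w 0 z := by simp [blowUp]
      have b1 : ‖blowUp v ξ w ρ z‖ ≤ R := norm_blowUp_le hρ0 hρ1 (hB z hzY) (hwS z hzY) (hgΛ z)
      have b2 : ‖blowUp v ξ w 0 z‖ ≤ R :=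
        norm_blowUp_le le_rfl zero_le_one (hB z hzY) (hwS z hzY) (hgΛ z)
      have b3 : dist (blowUp v ξ w 0 z) (blowUp v ξ w ρ z) < δ := by
        refine lt_of_le_of_lt ?_ hρδ
        rw [dist_comm, dist_eq_norm]
        have : blowUp v ξ w ρ z - blowUp v ξ w 0 z = (ρ • (matApply ξ z + w z), 0) := by
          simp [blowUp]
        rw [this, Prod.norm_def, norm_zero, max_eq_left (norm_nonneg _), norm_smul,
          Real.norm_of_nonneg hρ0]
        refine mul_le_mul_of_nonneg_left ((norm_add_le _ _).trans ?_) hρ0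
        exact add_le_add (hB z hzY) (hwS z hzY)
      have b4 := hfδ _ (by simpa using b2) _ (by simpa using b1) b3
      have b5 : f x (blowUp v ξ w 0 z) ≤ f x (blowUp v ξ w ρ z) + ε / 3 := by
        rw [← NNReal.coe_le_coe, NNReal.coe_add]
        rw [NNReal.dist_eq] at b4
        linarith [(abs_lt.1 b4).2]
      rw [e1, e2, Set.indicator_of_notMem (show z ∉ A from not_not.2 hzA), add_zero]
      calc (f x (blowUp v ξ w 0 z) : ℝ≥0∞) ≤ f x (blowUp v ξ w ρ z) + (ε / 3 : ℝ≥0) := by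
            exact_mod_cast b5
        _ ≤ (f (x + ρ • z) (blowUp v ξ w ρ z) + h (x + ρ • z)) + (ε / 3 : ℝ≥0) := by
            gcongr
            exact (hfh _ _ b1).2
        _ = _ := add_assoc _ _ _
    · rw [Set.indicator_of_mem (show z ∈ A from hzA)]
      have h1 : (f x (v, ξ + gradMat w z) : ℝ≥0∞) ≤ e :=
        ENNReal.coe_le_coe.2 (hc' _ _ (one_le_pow₀ one_le_two) (hgw z))
      exact h1.trans (le_add_left (le_add_left (le_add_left le_rfl)))
  have hmi : Measurable (A.indicator fun _ => e) := measurable_const.indicator hA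
  have hmh : Measurable fun z => h (x + ρ • z) := hhm.comp (by fun_prop)
  have m2 : Measurable fun z => ((ε / 3 : ℝ≥0) : ℝ≥0∞) + A.indicator (fun _ => e) z :=
    measurable_const.add hmi
  have m1 : Measurable fun z => h (x + ρ • z) +
      (((ε / 3 : ℝ≥0) : ℝ≥0∞) + A.indicator (fun _ => e) z) := hmh.add m2
  calc _ ≤ ∫⁻ z in unitCube d, (f x (v, ξ + gradMat w z) : ℝ≥0∞) := hD
    _ ≤ ∫⁻ z in unitCube d, (f (x + ρ • z) (blowUp v ξ ψ ρ z) +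
        (h (x + ρ • z) + ((ε / 3 : ℝ≥0) + A.indicator (fun _ => e) z)) : ℝ≥0∞) :=
        lintegral_mono_ae hpt
    _ = (∫⁻ z in unitCube d, (f (x + ρ • z) (blowUp v ξ ψ ρ z) : ℝ≥0∞)) +
        ((∫⁻ z in unitCube d, h (x + ρ • z)) + ((ε / 3 : ℝ≥0) +
          ∫⁻ z in unitCube d, A.indicator (fun _ => e) z)) := by
        rw [lintegral_add_right _ m1, lintegral_add_left hmh,
          lintegral_add_left measurable_const, setLIntegral_const, volume_unitCube, mul_one]
    _ ≤ T + (((ε / 3 : ℝ≥0) : ℝ≥0∞) + ((ε / 3 : ℝ≥0) + (ε / 3 : ℝ≥0))) := by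
        gcongr
        refine le_trans (setLIntegral_le_lintegral _ _) ?_
        rw [lintegral_indicator_const hA]
        exact hbad
    _ = T + ε := by
        rw [← ENNReal.coe_add, ← ENNReal.coe_add]
        congr 2
        ring

end LowerBound

/-! ### Regularisation of the integrand and assembly of both bounds. -/

section Main

variable {m d : ℕ}

/-- The hypotheses use the Frobenius norm, the proof the sup norm of `Fin m → Fin d → ℝ`. This
direction transfers coercivity, the next lemma growth. -/
theorem norm_le_matNorm (ξ : Fin m → Fin d → ℝ) : ‖ξ‖ ≤ matNorm ξ := by
  have h0 : 0 ≤ matNorm ξ := Real.sqrt_nonneg _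
  rw [pi_norm_le_iff_of_nonneg h0]
  intro i
  rw [pi_norm_le_iff_of_nonneg h0]
  intro j
  refine Real.le_sqrt_of_sq_le ?_
  rw [Real.norm_eq_abs, sq_abs]
  refine le_trans ?_ (Finset.single_le_sum (f := fun i => ∑ j, ξ i j ^ 2)
    (fun i _ => Finset.sum_nonneg fun j _ => sq_nonneg _) (Finset.mem_univ i))
  exact Finset.single_le_sum (f := fun j => ξ i j ^ 2) (fun j _ => sq_nonneg _) (Finset.mem_univ j)

theorem matNorm_le_mul_norm (ξ : Fin m → Fin d → ℝ) : matNorm ξ ≤ Real.sqrt (m * d) * ‖ξ‖ := by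
  rw [← Real.sqrt_sq (norm_nonneg ξ), ← Real.sqrt_mul (by positivity)]
  refine Real.sqrt_le_sqrt ?_
  have h : ∀ i j, ξ i j ^ 2 ≤ ‖ξ‖ ^ 2 := fun i j => by
    rw [← sq_abs]
    refine pow_le_pow_left₀ (abs_nonneg _) ?_ 2
    exact (norm_le_pi_norm (ξ i) j).trans (norm_le_pi_norm ξ i)
  refine (Finset.sum_le_sum fun i _ => Finset.sum_le_sum fun j _ => h i j).trans (le_of_eq ?_)
  simp [mul_assoc]

/-- A Carathéodory integrand agrees almost everywhere with a regular one. -/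
theorem exists_isRegularIntegrand {p : ℝ} (hp : 0 ≤ p) {Ω : Set (EuclideanSpace ℝ (Fin d))}
    (hΩ : MeasurableSet Ω)
    {L : EuclideanSpace ℝ (Fin d) → EuclideanSpace ℝ (Fin m) →
      Matrix (Fin m) (Fin d) ℝ → ℝ≥0} (hL : IsCaratheodory Ω L) (hgrowth : HasPGrowth p Ω L) :
    ∃ (f : EuclideanSpace ℝ (Fin d) → EuclideanSpace ℝ (Fin m) × (Fin m → Fin d → ℝ) → ℝ≥0)
      (a : EuclideanSpace ℝ (Fin d) → ℝ) (α : ℝ), 0 < α ∧ IsRegularIntegrand volume p a f ∧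
      ∀ᵐ y ∂(volume.restrict Ω), (∀ v ξ, L y v ξ = f y (v, ξ)) ∧
        ∀ w, α * ‖w.2‖ ^ p ≤ f y w := by
  classical
  obtain ⟨α, hα, β, hβ, a, ha, hgr⟩ := hgrowth
  let D : ℕ → EuclideanSpace ℝ (Fin m) × (Fin m → Fin d → ℝ) := TopologicalSpace.denseSeq _
  -- The null set where `L · v ξ` differs from its measurable version depends on `(v, ξ)`.
  -- Restricting to a dense sequence leaves one null set, and continuity recovers measurability for
  -- all arguments.
  let g : ℕ → EuclideanSpace ℝ (Fin d) → ℝ≥0 := fun k => (hL.measurable (D k).1 (D k).2).mk _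
  have hg : ∀ k, Measurable (g k) := fun k => (hL.measurable (D k).1 (D k).2).measurable_mk
  let P : EuclideanSpace ℝ (Fin d) → Prop := fun y =>
    (Continuous fun w : EuclideanSpace ℝ (Fin m) × (Fin m → Fin d → ℝ) => L y w.1 w.2) ∧
    (∀ v ξ, α * matNorm ξ ^ p ≤ (L y v ξ : ℝ) ∧
      (L y v ξ : ℝ) ≤ β * (a y + ‖v‖ ^ p + matNorm ξ ^ p)) ∧
    ∀ k, L y (D k).1 (D k).2 = g k y
  have hP : ∀ᵐ y ∂(volume.restrict Ω), P y := by
    have h3 : ∀ᵐ y ∂(volume.restrict Ω), ∀ k, L y (D k).1 (D k).2 = g k y :=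
      ae_all_iff.2 fun k => (hL.measurable (D k).1 (D k).2).ae_eq_mk
    filter_upwards [hL.continuous, hgr, h3] with y h1 h2 h3
    exact ⟨h1, h2, h3⟩
  have hP' : volume {y | ¬ (y ∈ Ω → P y)} = 0 := (ae_restrict_iff' hΩ).1 hP
  let Ω₀ := Ω \ toMeasurable volume {y | ¬ (y ∈ Ω → P y)}
  have hΩ₀ : MeasurableSet Ω₀ := hΩ.diff (measurableSet_toMeasurable _ _)
  have hsub : Ω₀ ⊆ Ω := Set.sdiff_subset
  have hΩP : ∀ y ∈ Ω₀, P y := fun y hy => by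
    by_contra h
    exact hy.2 (subset_toMeasurable _ _ fun h' => h (h' hy.1))
  have hae : ∀ᵐ y ∂(volume.restrict Ω), y ∈ Ω₀ := by
    rw [ae_restrict_iff' hΩ]
    have : ∀ᵐ y, y ∉ toMeasurable volume {y | ¬ (y ∈ Ω → P y)} := by
      rw [← measure_eq_zero_iff_ae_notMem, measure_toMeasurable]
      exact hP'
    filter_upwards [this] with y h1 h2
    exact ⟨h2, h1⟩
  let f : EuclideanSpace ℝ (Fin d) → EuclideanSpace ℝ (Fin m) × (Fin m → Fin d → ℝ) → ℝ≥0 :=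
    fun y w => if y ∈ Ω₀ then L y w.1 w.2 else 0
  have hfL : ∀ y ∈ Ω₀, ∀ w, f y w = L y w.1 w.2 := fun y hy w => if_pos hy
  have hf0 : ∀ y ∉ Ω₀, ∀ w, f y w = 0 := fun y hy w => if_neg hy
  have hfc : ∀ y, Continuous (f y) := by
    intro y
    by_cases hy : y ∈ Ω₀
    · exact (hΩP y hy).1.congr fun w => (hfL y hy w).symm
    · exact continuous_const.congr fun w => (hf0 y hy w).symm
  refine ⟨f, Ω₀.indicator fun y => β * |a y|, α, hα, ⟨hfc, fun w => ?_, fun y => ?_, ?_, ?_⟩, ?_⟩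
  · obtain ⟨u, hu, hlim⟩ := mem_closure_iff_seq_limit.1
      (TopologicalSpace.denseRange_denseSeq (EuclideanSpace ℝ (Fin m) × (Fin m → Fin d → ℝ)) w)
    choose k hk using hu
    refine measurable_of_tendsto_metrizable (f := fun n y => Ω₀.indicator (g (k n)) y)
      (fun n => (hg _).indicator hΩ₀) (tendsto_pi_nhds.2 fun y => ?_)
    refine (((hfc y).tendsto w).comp hlim).congr fun n => ?_
    rw [Function.comp_apply, ← hk n]
    by_cases hy : y ∈ Ω₀
    · rw [hfL y hy, Set.indicator_of_mem hy, (hΩP y hy).2.2]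
    · rw [hf0 y hy, Set.indicator_of_notMem hy]
  · exact Set.indicator_nonneg (fun y _ => by positivity) y
  · rw [integrable_indicator_iff hΩ₀]
    exact ((ha.mono_set hsub).abs).const_mul β
  · refine ⟨β * (1 + Real.sqrt (m * d) ^ p), by positivity, fun y w => ?_⟩
    by_cases hy : y ∈ Ω₀
    · rw [hfL y hy, Set.indicator_of_mem hy]
      refine ((hΩP y hy).2.1 w.1 w.2).2.trans ?_
      have h1 : ‖w.1‖ ^ p ≤ ‖w‖ ^ p := Real.rpow_le_rpow (norm_nonneg _) (norm_fst_le w) hp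
      have h2 : matNorm w.2 ^ p ≤ Real.sqrt (m * d) ^ p * ‖w‖ ^ p := by
        rw [← Real.mul_rpow (Real.sqrt_nonneg _) (norm_nonneg _)]
        refine Real.rpow_le_rpow (Real.sqrt_nonneg _) ((matNorm_le_mul_norm w.2).trans ?_) hp
        gcongr
        exact norm_snd_le w
      calc β * (a y + ‖w.1‖ ^ p + matNorm w.2 ^ p)
          ≤ β * (|a y| + ‖w‖ ^ p + Real.sqrt (m * d) ^ p * ‖w‖ ^ p) := by
            gcongr
            exact le_abs_self _
        _ = _ := by ring
    · rw [hf0 y hy, Set.indicator_of_notMem hy, NNReal.coe_zero]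
      positivity
  · filter_upwards [hae] with y hy
    refine ⟨fun v ξ => (hfL y hy (v, ξ)).symm, fun w => ?_⟩
    rw [hfL y hy]
    refine le_trans ?_ ((hΩP y hy).2.1 w.1 w.2).1
    gcongr
    exact norm_le_matNorm w.2

theorem ae_unitCube_of_ae_cube {x : EuclideanSpace ℝ (Fin d)} {ρ : ℝ} (hρ : 0 < ρ)
    {P : EuclideanSpace ℝ (Fin d) → Prop} (h : ∀ᵐ y ∂(volume.restrict (cube x ρ)), P y) :
    ∀ᵐ z ∂(volume.restrict (unitCube d)), P (x + ρ • z) := by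
  rw [ae_restrict_iff' (measurableSet_cube x ρ)] at h
  obtain ⟨N, hN, hNm, hN0⟩ := exists_measurable_superset_of_null h
  have h1 := lintegral_comp_affine x hρ (N.indicator 1)
  rw [lintegral_indicator_one hNm, hN0, mul_eq_zero] at h1
  have h2 := h1.resolve_left (by simp [hρ])
  have hmeas : Measurable fun z => N.indicator (1 : EuclideanSpace ℝ (Fin d) → ℝ≥0∞) (x + ρ • z) :=
    (measurable_one.indicator hNm).comp (by fun_prop)
  rw [lintegral_eq_zero_iff hmeas] at h2
  rw [ae_restrict_iff' (show MeasurableSet (unitCube d) from measurableSet_cube 0 1)]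
  filter_upwards [h2] with z hz hzY
  by_contra hP
  have hmem : x + ρ • z ∈ N := hN fun h' => hP (h' ((mem_cube_iff_mem_unitCube x z hρ).2 hzY))
  simp [hmem] at hz

theorem matApply_smul (ξ : Matrix (Fin m) (Fin d) ℝ) (ρ : ℝ) (z : EuclideanSpace ℝ (Fin d)) :
    matApply ξ (ρ • z) = ρ • matApply ξ z :=
  (Matrix.toEuclideanLin ξ).map_smul ρ z

/-- Test maps belong to `W^{1,∞}_0`, giving one inequality; the other is the mollification result
applied to `ζ ↦ F (v, ξ + ζ)`. -/
theorem dacorognaFormula_eq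
    {L : EuclideanSpace ℝ (Fin d) → EuclideanSpace ℝ (Fin m) → Matrix (Fin m) (Fin d) ℝ → ℝ≥0}
    {F : EuclideanSpace ℝ (Fin m) × (Fin m → Fin d → ℝ) → ℝ≥0} (hF : Continuous F)
    {x : EuclideanSpace ℝ (Fin d)} (hLF : ∀ v ξ, L x v ξ = F (v, ξ))
    (v : EuclideanSpace ℝ (Fin m)) (ξ : Fin m → Fin d → ℝ) :
    dacorognaFormula L x v ξ =
      ⨅ (ψ : EuclideanSpace ℝ (Fin d) → EuclideanSpace ℝ (Fin m))
        (_ : IsTestFunction (unitCube d) ψ),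
        ∫⁻ z in unitCube d, (F (v, ξ + gradMat ψ z) : ℝ≥0∞) := by
  refine le_antisymm (le_iInf₂ fun ψ hψ => ?_) (le_iInf₂ fun φ G => le_iInf fun h => ?_)
  · refine (iInf₂_le_of_le ψ (gradMat ψ) (iInf_le_of_le hψ.memW10Infty ?_))
    simp only [hLF]
    exact le_rfl
  · by_contra! hlt
    simp only [hLF] at hlt
    obtain ⟨ψ, hψ, hψ'⟩ := exists_testFunction_of_memW10Infty h
      (g := fun ζ => F (v, ξ + ζ)) (by fun_prop) hlt
    exact absurd hψ' (not_lt.2 (iInf₂_le ψ hψ))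

section Cell

variable {L : EuclideanSpace ℝ (Fin d) → EuclideanSpace ℝ (Fin m) →
    Matrix (Fin m) (Fin d) ℝ → ℝ≥0}
  {f : EuclideanSpace ℝ (Fin d) → EuclideanSpace ℝ (Fin m) × (Fin m → Fin d → ℝ) → ℝ≥0}
  {x : EuclideanSpace ℝ (Fin d)} {ρ : ℝ}

/-- The infimum problem on a cube, in the cell formula. -/
noncomputable def cellInf (p : ℝ)
    (L : EuclideanSpace ℝ (Fin d) → EuclideanSpace ℝ (Fin m) → Matrix (Fin m) (Fin d) ℝ → ℝ≥0)
    (x : EuclideanSpace ℝ (Fin d)) (v : EuclideanSpace ℝ (Fin m)) (ξ : Matrix (Fin m) (Fin d) ℝ)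
    (ρ : ℝ) : ℝ≥0∞ :=
  ⨅ (φ : EuclideanSpace ℝ (Fin d) → EuclideanSpace ℝ (Fin m))
    (G : EuclideanSpace ℝ (Fin d) → Matrix (Fin m) (Fin d) ℝ)
    (_ : MemW10 (ENNReal.ofReal p) (cube x ρ) φ G),
    ⨍⁻ y in cube x ρ, (L y (v + matApply ξ (y - x) + φ y) (ξ + G y) : ℝ≥0∞) ∂volume

theorem cellInf_le (p : ℝ) (hρ : 0 < ρ)
    (hLf : ∀ᵐ y ∂(volume.restrict (cube x ρ)), ∀ v ξ, L y v ξ = f y (v, ξ))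
    (v : EuclideanSpace ℝ (Fin m)) (ξ : Matrix (Fin m) (Fin d) ℝ)
    {ψ : EuclideanSpace ℝ (Fin d) → EuclideanSpace ℝ (Fin m)}
    (hψ : IsTestFunction (unitCube d) ψ) :
    cellInf p L x v ξ ρ ≤
      ∫⁻ z in unitCube d, (f (x + ρ • z) (blowUp v ξ ψ ρ z) : ℝ≥0∞) := by
  obtain ⟨φ, hφ, hφψ, hg⟩ := hψ.rescale x hρ
  refine iInf₂_le_of_le φ (gradMat φ) (iInf_le_of_le (hφ.memW10 _) ?_)
  rw [setLAverage_cube_eq x hρ]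
  refine lintegral_mono_ae ?_
  filter_upwards [ae_unitCube_of_ae_cube hρ hLf] with z hz
  rw [hz, hφψ, hg, add_sub_cancel_left, matApply_smul, add_assoc, ← smul_add]
  exact le_rfl

/-- A competitor with average below `T` is replaced by a test map on the same cube, using density
and `p`-growth, and then transported to the unit cube. -/
theorem exists_testFunction_of_cellInf_lt {p : ℝ} (hp : 1 ≤ p)
    {a : EuclideanSpace ℝ (Fin d) → ℝ} (hf : IsRegularIntegrand volume p a f) (hρ : 0 < ρ)
    (hLf : ∀ᵐ y ∂(volume.restrict (cube x ρ)), ∀ v ξ, L y v ξ = f y (v, ξ))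
    (v : EuclideanSpace ℝ (Fin m)) (ξ : Matrix (Fin m) (Fin d) ℝ) {T : ℝ≥0∞}
    (hT : cellInf p L x v ξ ρ < T) :
    ∃ ψ : EuclideanSpace ℝ (Fin d) → EuclideanSpace ℝ (Fin m), IsTestFunction (unitCube d) ψ ∧
      ∫⁻ z in unitCube d, (f (x + ρ • z) (blowUp v ξ ψ ρ z) : ℝ≥0∞) < T := by
  simp only [cellInf, iInf_lt_iff] at hT
  obtain ⟨φ, G, h, hT⟩ := hT
  let G' : EuclideanSpace ℝ (Fin d) → Fin m → Fin d → ℝ := G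
  have hv0 : volume (cube x ρ) ≠ 0 := by rw [volume_cube x hρ]; simp [hρ]
  have hv1 : volume (cube x ρ) ≠ ⊤ := by rw [volume_cube x hρ]; exact ENNReal.ofReal_ne_top
  let b : EuclideanSpace ℝ (Fin d) → EuclideanSpace ℝ (Fin m) × (Fin m → Fin d → ℝ) :=
    fun y => (v + matApply ξ (y - x), ξ)
  have hbc : Continuous b := by
    have := continuous_matApply ξ
    fun_prop
  have hbp : MemLp b (ENNReal.ofReal p) (volume.restrict (cube x ρ)) := by
    have : IsFiniteMeasure (volume.restrict (cube x ρ)) := ⟨by simpa using hv1.lt_top⟩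
    obtain ⟨C, hC⟩ := (isCompact_closedBall x ((d + 1) * ρ)).exists_bound_of_continuousOn
      hbc.continuousOn
    refine MemLp.of_bound hbc.aestronglyMeasurable C ?_
    filter_upwards [ae_restrict_mem (measurableSet_cube x ρ)] with y hy
    exact hC y (cube_subset_closedBall x hρ hy)
  rw [setLAverage_eq, ENNReal.div_lt_iff (Or.inl hv0) (Or.inl hv1)] at hT
  have hT' : ∫⁻ y in cube x ρ, (f y (b y + (φ y, G' y)) : ℝ≥0∞) <
      T * volume (cube x ρ) := by
    refine lt_of_le_of_lt (lintegral_mono_ae ?_) hT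
    filter_upwards [hLf] with y hy
    rw [hy]
    exact le_rfl
  obtain ⟨χ, hχ, hχT⟩ := hf.exists_testFunction_lintegral_lt hp hbc.measurable hbp (G := G') h hT'
  rw [← ENNReal.div_lt_iff (Or.inl hv0) (Or.inl hv1), ← setLAverage_eq,
    setLAverage_cube_eq x hρ] at hχT
  obtain ⟨ψ, hψ, hψχ, hg⟩ := hχ.unscale hρ
  refine ⟨ψ, hψ, lt_of_le_of_lt (le_of_eq ?_) hχT⟩
  congr 1
  ext z
  simp only [b, blowUp, hψχ, hg, add_sub_cancel_left, matApply_smul, smul_add]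
  rw [← add_assoc]
  rfl

end Cell

end Main

end CalcVar

theorem mainTheorem7 {m d : ℕ} (hm : 1 ≤ m) (hd : 1 ≤ d) (p : ℝ) (hp : 1 < p)
    (Ω : Set (EuclideanSpace ℝ (Fin d))) (hΩ : IsOpen Ω)
    (L : EuclideanSpace ℝ (Fin d) → EuclideanSpace ℝ (Fin m) →
      Matrix (Fin m) (Fin d) ℝ → ℝ≥0)
    (hL : CalcVar.IsCaratheodory Ω L) (hgrowth : CalcVar.HasPGrowth p Ω L) :
    ∀ᵐ x ∂(volume.restrict Ω), ∀ (v : EuclideanSpace ℝ (Fin m)) (ξ : Matrix (Fin m) (Fin d) ℝ),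
      CalcVar.cellIntegrand p L x v ξ = CalcVar.dacorognaFormula L x v ξ := by
  have hp0 : 0 ≤ p := by linarith
  obtain ⟨f, a, α, hα, hf, hae⟩ := CalcVar.exists_isRegularIntegrand hp0 hΩ.measurableSet hL hgrowth
  obtain ⟨c, hc, hup⟩ := hf.upper
  filter_upwards [hae, ae_restrict_mem hΩ.measurableSet,
    ae_restrict_of_ae (hf.ae_isUniformLebesguePoint hp0)] with x hx hxΩ hxL v ξ
  have hcubes : ∀ᶠ ρ : ℝ in 𝓝[>] 0, 0 < ρ ∧ CalcVar.cube x ρ ⊆ Ω :=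
    eventually_mem_nhdsWithin.and (CalcVar.cube_subset_of_mem_nhds (hΩ.mem_nhds hxΩ))
  refine Eq.trans ?_ (CalcVar.dacorognaFormula_eq (hf.continuous x) hx.1 v ξ).symm
  change limsup (CalcVar.cellInf p L x v ξ) (𝓝[>] 0) = _
  -- Each test map bounds the limsup from above. Conversely, any `T` above the limsup exceeds the
  -- cell infimum at all small `ρ`, which provides near-minimisers of energy below `T`.
  refine le_antisymm (le_iInf₂ fun ψ hψ => ?_)
    (le_of_forall_gt_imp_ge_of_dense fun T hT => ?_)
  · refine le_trans (limsup_le_limsup ?_)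
      (CalcVar.limsup_lintegral_blowUp_le (hf.continuous x) hxL v ξ hψ)
    filter_upwards [hcubes] with ρ hρ
    refine CalcVar.cellInf_le p hρ.1 ?_ v ξ hψ
    filter_upwards [ae_restrict_of_ae_restrict_of_subset hρ.2 hae] with y hy using hy.1
  · rcases eq_or_ne T ⊤ with rfl | hT'
    · exact le_top
    refine CalcVar.iInf_testFunction_le_of_eventually hd hp (hf.continuous x) (hf.nonneg x) hc
      (hup x) hxL hα ?_ v ξ hT' ?_
    · filter_upwards [hcubes] with ρ hρ
      refine CalcVar.ae_unitCube_of_ae_cube hρ.1 (P := fun y => ∀ w, α * ‖w.2‖ ^ p ≤ f y w) ?_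
      filter_upwards [ae_restrict_of_ae_restrict_of_subset hρ.2 hae] with y hy using hy.2
    · filter_upwards [hcubes, eventually_lt_of_limsup_lt hT] with ρ hρ hρT
      refine CalcVar.exists_testFunction_of_cellInf_lt hp.le hf hρ.1 ?_ v ξ hρT
      filter_upwards [ae_restrict_of_ae_restrict_of_subset hρ.2 hae] with y hy using hy.1
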